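/- **Setting.** An MPS tensor is a family of complex $D\times D$ matrices $A=(A^i)_{i=1}^d$. Blocking $\ell\ge 1$ sites gives the tensor $A^{[\ell]}$ whose matrices $A^{i_1}\cdots A^{i_\ell}$ are indexed by words $i_1\dots i_\ell$. An MPS with boundary $(X,A)$ generates the states $|\psi_N(X,A)\rangle=\sum_{i_1,\dots,i_N}\operatorname{tr}(XA^{i_1}\cdots A^{i_N})\,|i_1\dots i_N\rangle$, $N\ge1$. Two of them are *equivalent* if they generate the same state for every $N\ge 1$. The basis of the bond space is split into ordered blocks, with respect to which all $A^i$ are block upper triangular, and each diagonal block (as a family of matrices indexed by $i$) is irreducible, i.e. nonzero-dimensional and without a common nontrivial invariant subspace (a $1\times1$ zero block is allowed). $(X,A)$ is a *uniform PBC MPS* if $X=\mathbb 1$ and all $A^i$ are block diagonal. **Matrix canonical form.** A tensor $T$ is in *matrix canonical form* if, for some partition of the bond basis into ordered blocks, it is block upper triangular, $T^i_{kl}=\sum_{t\in\Sigma}(T_{\rm low}^t)_{kl}\,T_{\rm up}^{t,i}$, where $\Sigma=\Sigma_\infty\sqcup\Sigma_f$ is a finite set of free blocks and * every block row $k$ has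 a class $c(k)\in\Sigma_\infty\cup\{\varepsilon\}$; blocks of class $j\in\Sigma_\infty$ have a size $D_j\ge1$, those of class $\varepsilon$ have size $1$; every $t\in\Sigma$ has a sector in $(\Sigma_\infty\cup\{\varepsilon\})^2$, which is $(j,j)$ for $t=j\in\Sigma_\infty$, and $(T^t_{\rm low})_{kl}\neq0$ only if $(c(k),c(l))$ is the sector of $t$; * the diagonal block $(k,k)$ is zero if $c(k)=\varepsilon$, and a nonzero multiple of the free block $T_{\rm up}^{j,i}$ if $c(k)=j$; * each $t\in\Sigma_\infty$ (resp. $t\in\Sigma_f$) occurs, with coefficient $1$ and no other free block added, as some diagonal (resp. strictly upper off-diagonal) block of $T$; * block injectivity: the tuples $(T_{\rm up}^{t,i})_{t\in\Sigma}$, as $i$ varies, span the space of all tuples of matrices of the respective sizes. A free block $t$ is *negligible* for a boundary matrix $Y$ if replacing $T_{\rm up}^{t}$ by $0$ does not change any of the states $|\psi_N(Y,T)\rangle$, $N\ge1$. **Reduced pairs.** A pair of equivalent MPS with boundary $(X_A,A)$, $(X_B,B)$ is *reduced* if 1. neither contains negligible blocks: there are $L\ge1$ and an invertible $P$ such that $PA^{[Lm]}P^{-1}$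 is in matrix canonical form for all $m\ge1$; and for all $\ell\ge1$, all invertible $P$ and every matrix canonical form of $PA^{[\ell]}P^{-1}$, no free block is negligible for $PX_AP^{-1}$; the same holds for $(X_B,B)$; 2. they have no additive gauge freedom relative to each other: for $C^i=A^i\oplus B^i$ there are $L\ge1$ and an invertible $P$, strictly block diagonal with respect to the blocks of $A$ and $B$, such that for all $m\ge1$ the tensor $PC^{[Lm]}P^{-1}$ is in matrix canonical form, with an ordered block partition that refines the (ordered) blocks of $A$ followed by those of $B$; and the same with $A$ and $B$ exchanged; 3. they span the same physical subspace: $V_A=V_B$, where $V_A=\{\sum_i\operatorname{tr}(A^iY)|i\rangle : Y\in M_{D_A}(\mathbb C)\}$, and also $V_{A^{[\ell]}}=V_{B^{[\ell]}}$ for all $\ell\ge1$. **Lemma.** Any pair of equivalent uniform PBC MPS is reduced. -/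

import Mathlib

open Matrix

namespace MPSX

/-- The product `A^{w 0} * ⋯ * A^{w (ℓ-1)}` for every word `w` of length `ℓ`: the tensor obtained
from `A` by blocking `ℓ` sites. -/
def blockSites {ι n : Type*} [Fintype n] [DecidableEq n]
    (A : ι → Matrix n n ℂ) (ℓ : ℕ) : (Fin ℓ → ι) → Matrix n n ℂ :=
  fun w => (List.ofFn fun k => A (w k)).prod

/-- The state `ψ_N(X, A)`, given by its amplitudes `tr (X * A^{w 0} * ⋯ * A^{w (N-1)})`. -/
def state {ι n : Type*} [Fintype n] [DecidableEq n]
    (X : Matrix n n ℂ) (A : ι → Matrix n n ℂ) (N : ℕ) : (Fin N → ι) → ℂ :=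
  fun w => (X * blockSites A N w).trace

/-- The matrices `A^i` have no common nontrivial invariant subspace. -/
def IsIrreducibleFamily {ι n : Type*} [Fintype n] (A : ι → Matrix n n ℂ) : Prop :=
  Nonempty n ∧ ∀ W : Submodule ℂ (n → ℂ),
    (∀ i, ∀ v ∈ W, A i *ᵥ v ∈ W) → W = ⊥ ∨ W = ⊤

/-- The gauge transform `P A^i P⁻¹`. -/
def gauge {ω n : Type*} [Fintype n] [DecidableEq n]
    (P : (Matrix n n ℂ)ˣ) (T : ω → Matrix n n ℂ) : ω → Matrix n n ℂ :=
  fun i => P.val * T i * P.inv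

/-- `M` has no nonzero entry between basis vectors with different labels. -/
def IsLabelDiagonal {n κ : Type*} (label : n → κ) (M : Matrix n n ℂ) : Prop :=
  ∀ x y, label x ≠ label y → M x y = 0

/-- A matrix product state with boundary: a tensor `A^i` with physical index `i : ι` and a
boundary matrix `X`. The bond basis `n` carries a partition into blocks labelled by `κ`, with
respect to which the `A^i` are block upper triangular with irreducible diagonal blocks
(a `1 × 1` zero block is allowed); every tensor takes this form in a suitable basis. -/
structure Rep (ι n κ : Type*) [Fintype n] [LinearOrder κ] where
  tensor : ι → Matrix n n ℂ
  boundary : Matrix n n ℂ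
  label : n → κ
  upper : ∀ i, (tensor i).BlockTriangular label
  irreducible : ∀ k, IsIrreducibleFamily fun i => (tensor i).toSquareBlock label k

/-- A uniform MPS with periodic boundary conditions: trivial boundary, block diagonal tensor. -/
def Rep.IsUniformPBC {ι n κ : Type*} [Fintype n] [DecidableEq n] [LinearOrder κ]
    (M : Rep ι n κ) : Prop :=
  M.boundary = 1 ∧ ∀ i, IsLabelDiagonal M.label (M.tensor i)

/-- Two representations are equivalent if they generate the same state for every size `N ≥ 1`. -/
def Rep.Equivalent {ι n κ n' κ' : Type*} [Fintype n] [DecidableEq n] [LinearOrder κ]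
    [Fintype n'] [DecidableEq n'] [LinearOrder κ'] (M : Rep ι n κ) (M' : Rep ι n' κ') : Prop :=
  ∀ N, 1 ≤ N → state M.boundary M.tensor N = state M'.boundary M'.tensor N

/-- Size of a diagonal block of class `o`; the class `none` (written `ε` in the literature)
stands for the `1 × 1` zero diagonal blocks. -/
def blockDim {q : ℕ} (dim : Fin q → ℕ) : Option (Fin q) → ℕ
  | none => 1
  | some j => dim j

/-- The sector (row class, column class) of a free block: the free diagonal block `j` lies in
sector `(j, j)`. -/
def sectorOf {q g : ℕ} (sector : Fin g → Option (Fin q) × Option (Fin q)) :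
    Fin q ⊕ Fin g → Option (Fin q) × Option (Fin q)
  | .inl j => (some j, some j)
  | .inr f => sector f

/-- The tensor whose block in position `(k, l)` is `∑ t, low^t_{kl} • up^t`, where `e` cuts the
bond basis into blocks `k : Fin s` of class `cls k`. The matrix `up t i` is indexed by the direct
sum of one block space for each class. -/
def assemble {ω n : Type*} {q s : ℕ} {τ : Type*} [Fintype τ] {dim : Fin q → ℕ}
    {cls : Fin s → Option (Fin q)}
    (e : n ≃ Σ k : Fin s, Fin (blockDim dim (cls k)))
    (up : τ → ω → Matrix (Σ o, Fin (blockDim dim o)) (Σ o, Fin (blockDim dim o)) ℂ)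
    (low : τ → Matrix (Fin s) (Fin s) ℂ) : ω → Matrix n n ℂ :=
  fun i x y => ∑ t, low t (e x).1 (e y).1 *
    up t i ⟨cls (e x).1, (e x).2⟩ ⟨cls (e y).1, (e y).2⟩

/-- A matrix canonical form of the tensor `T`. The free blocks are labelled by
`Σ = Σ_∞ ⊕ Σ_f = Fin q ⊕ Fin g` (diagonal and off-diagonal ones). -/
structure MatrixCF {ω n : Type*} (T : ω → Matrix n n ℂ) where
  /-- number of free diagonal blocks -/
  q : ℕ
  /-- number of free off-diagonal blocks -/
  g : ℕ
  /-- sizes of the free diagonal blocks -/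
  dim : Fin q → ℕ
  dim_pos : ∀ j, 0 < dim j
  /-- sectors of the free off-diagonal blocks -/
  sector : Fin g → Option (Fin q) × Option (Fin q)
  /-- number of block rows -/
  s : ℕ
  cls : Fin s → Option (Fin q)
  e : n ≃ Σ k : Fin s, Fin (blockDim dim (cls k))
  up : Fin q ⊕ Fin g → ω →
    Matrix (Σ o, Fin (blockDim dim o)) (Σ o, Fin (blockDim dim o)) ℂ
  low : Fin q ⊕ Fin g → Matrix (Fin s) (Fin s) ℂ
  eq_assemble : T = assemble e up low
  /-- The tensor is block upper triangular. -/
  low_upper : ∀ t k l, l < k → low t k l = 0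
  /-- Every block is a linear combination of the free blocks of its own sector. -/
  low_sector : ∀ t k l, low t k l ≠ 0 → (cls k, cls l) = sectorOf sector t
  /-- A diagonal block contains no off-diagonal free block: it is zero if its class is `none`, and
  otherwise (next field) a nonzero multiple of the free diagonal block of its class. -/
  low_diag_inr : ∀ f k, low (.inr f) k k = 0
  low_diag_inl : ∀ j k, cls k = some j → low (.inl j) k k ≠ 0
  /-- Every free diagonal block occurs as a diagonal block. -/
  realized_inl : ∀ j, ∃ k, ∀ t, low t k k = if t = .inl j then 1 else 0
  /-- Every free off-diagonal block occurs as an off-diagonal block. -/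
  realized_inr : ∀ f, ∃ k l, k < l ∧ ∀ t, low t k l = if t = .inr f then 1 else 0
  /-- Block injectivity: jointly, the free blocks take all values, independently of each other
  (and each is supported in its sector). -/
  block_injective : ∀ F : Fin q ⊕ Fin g →
      Matrix (Σ o, Fin (blockDim dim o)) (Σ o, Fin (blockDim dim o)) ℂ,
    F ∈ Submodule.span ℂ (Set.range fun i => fun t => up t i) ↔
      ∀ t x y, F t x y ≠ 0 → (x.1, y.1) = sectorOf sector t

/-- The free block `t` is negligible for the boundary matrix `X`: setting it to zero does not
change the generated states. -/
def MatrixCF.Negligible {ω n : Type*} [Fintype n] [DecidableEq n] {T : ω → Matrix n n ℂ}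
    (cf : MatrixCF T) (X : Matrix n n ℂ) (t : Fin cf.q ⊕ Fin cf.g) : Prop :=
  ∀ N, 1 ≤ N → state X (assemble cf.e (Function.update cf.up t 0) cf.low) N = state X T N

/-- The block decomposition of a matrix canonical form refines, in an order preserving way, a
given decomposition into labelled blocks. -/
def MatrixCF.Refines {ω n κ : Type*} [LinearOrder κ] {T : ω → Matrix n n ℂ}
    (cf : MatrixCF T) (label : n → κ) : Prop :=
  ∃ f : Fin cf.s → κ, Monotone f ∧ ∀ x, label x = f (cf.e x).1

/-- No negligible blocks: after sufficient blocking and a gauge transformation the tensor is in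
matrix canonical form, and no matrix canonical form obtained from it by blocking and a gauge
transformation contains a negligible block. -/
def Rep.NoNegligibleBlocks {ι n κ : Type*} [Fintype n] [DecidableEq n] [LinearOrder κ]
    (M : Rep ι n κ) : Prop :=
  (∃ L, 1 ≤ L ∧ ∃ P : (Matrix n n ℂ)ˣ, ∀ m, 1 ≤ m →
    Nonempty (MatrixCF (gauge P (blockSites M.tensor (L * m))))) ∧
  ∀ ℓ, 1 ≤ ℓ → ∀ (P : (Matrix n n ℂ)ˣ) (cf : MatrixCF (gauge P (blockSites M.tensor ℓ)))
    (t : Fin cf.q ⊕ Fin cf.g), ¬ cf.Negligible (P.val * M.boundary * P.inv) t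

/-- The stacked tensor `A^i ⊕ B^i`. -/
def stack {ι n n' : Type*} (A : ι → Matrix n n ℂ) (B : ι → Matrix n' n' ℂ) :
    ι → Matrix (n ⊕ n') (n ⊕ n') ℂ :=
  fun i => Matrix.fromBlocks (A i) 0 0 (B i)

/-- The blocks of the stacked tensor: first those of `A`, then those of `B`. -/
def stackLabel {n n' κ κ' : Type*} (a : n → κ) (b : n' → κ') : n ⊕ n' → Lex (κ ⊕ κ') :=
  fun x => toLex (Sum.map a b x)

/-- `M'` has no additive gauge freedom with respect to `M`: after sufficient blocking, a strictly
block diagonal gauge transformation brings the stacked tensor into matrix canonical form. -/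
def Rep.NoAdditiveGaugeFreedom {ι n κ n' κ' : Type*} [Fintype n] [DecidableEq n] [LinearOrder κ]
    [Fintype n'] [DecidableEq n'] [LinearOrder κ'] (M : Rep ι n κ) (M' : Rep ι n' κ') : Prop :=
  ∃ L, 1 ≤ L ∧ ∃ P : (Matrix (n ⊕ n') (n ⊕ n') ℂ)ˣ,
    IsLabelDiagonal (stackLabel M.label M'.label) P.val ∧
    ∀ m, 1 ≤ m →
      ∃ cf : MatrixCF (gauge P (blockSites (stack M.tensor M'.tensor) (L * m))),
        cf.Refines (stackLabel M.label M'.label)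

/-- The physical subspace `V_A = { ∑ i, tr (A^i Y) |i⟩ : Y }`. -/
def physicalSubspace {ι n : Type*} [Fintype n] (A : ι → Matrix n n ℂ) : Submodule ℂ (ι → ℂ) :=
  LinearMap.range
    (LinearMap.pi fun i => Matrix.traceLinearMap n ℂ ℂ ∘ₗ LinearMap.mulLeft ℂ (A i))

/-- A reduced pair of equivalent representations. The last field is the equality of physical
subspaces for the blocked tensors, to which the first fields refer. -/
structure IsReducedPair {ι n κ n' κ' : Type*} [Fintype n] [DecidableEq n] [LinearOrder κ]
    [Fintype n'] [DecidableEq n'] [LinearOrder κ'] (M : Rep ι n κ) (M' : Rep ι n' κ') : Prop where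
  equivalent : M.Equivalent M'
  no_negligible_left : M.NoNegligibleBlocks
  no_negligible_right : M'.NoNegligibleBlocks
  no_additive_left : M.NoAdditiveGaugeFreedom M'
  no_additive_right : M'.NoAdditiveGaugeFreedom M
  same_subspace : physicalSubspace M.tensor = physicalSubspace M'.tensor
  same_subspace_blocked : ∀ ℓ, 1 ≤ ℓ →
    physicalSubspace (blockSites M.tensor ℓ) = physicalSubspace (blockSites M'.tensor ℓ)

end MPSX

namespace MPSX

/-! Everything rests on one vanishing principle, `eq_zero_of_isNilpotent_mul`. Let a space of
operators leave invariant a family of irreducible subspaces that together span the whole space. If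
`N` preserves these subspaces and `N * w` is nilpotent for every word `w`, then `N = 0`: on each
subspace the words span all endomorphisms by Burnside's theorem, and the trace form is
nondegenerate. The irreducible blocks may become reducible under words of a fixed length `ℓ`. Still,
if `N` lies in the algebra generated by such words, testing against that algebra suffices
(`isNilpotent_mul_of_forall_adjoin_pow`).

The principle has three uses. It kills the radical of the blocked algebra, so invariant subspaces of
blocked words have invariant complements (`exists_isCompl_invariant`). It excludes free off-diagonal
blocks: block injectivity would isolate such a block as a strictly upper triangular element of the
blocked algebra (`MatrixCF.isEmpty_fin_g`). And it transports linear relations from one tensor to an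
equivalent one: a combination of words that vanishes on one side has nilpotent products with words
on the other, because traces agree (`snd_eq_zero_of_mem_span_pow`). The relations among the matrices
determine the physical subspace by duality.

A free diagonal block is never negligible: a combination of matrices that puts the identity in this
block and zero in the others would have traceless powers, yet it is triangular with a diagonal entry
1 (`MatrixCF.not_negligible_inl`).

For the existence of canonical forms, each block is split under longer and longer blocking until the
pieces stay irreducible under all further blocking. A nonzero piece of this kind has its full matrix
algebra spanned by words of one fixed length (`exists_pow_eq_top`). Two such pieces are either
separated by a combination of words of one length or conjugate up to a scalar
(`exists_separating_or_conjugate`), and products of separators give block injectivity. All these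
arguments must stay homogeneous in word length, which is why lengths are padded and scalars appear.
Applied to the direct sum of both tensors, the same construction excludes additive gauge freedom. -/

open Module

/-! ### Traces, nilpotency and Burnside's theorem -/

section Endomorphisms

variable {V : Type*} [AddCommGroup V] [Module ℂ V] [FiniteDimensional ℂ V]

/-- An endomorphism all of whose positive powers are traceless is nilpotent. -/
theorem isNilpotent_of_trace_pow_eq_zero (f : End ℂ V)
    (h : ∀ k, 1 ≤ k → LinearMap.trace ℂ V (f ^ k) = 0) : IsNilpotent f := by
  have hX : ∀ p : Polynomial ℂ, LinearMap.trace ℂ V (Polynomial.aeval f (p * Polynomial.X)) = 0 := by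
    intro p
    induction p using Polynomial.induction_on' with
    | add p q hp hq => rw [add_mul, map_add, map_add, hp, hq, add_zero]
    | monomial k a =>
      rw [Polynomial.monomial_mul_X, Polynomial.aeval_monomial, ← Algebra.smul_def, map_smul,
        h _ (Nat.le_add_left 1 k), smul_zero]
  obtain ⟨q, hq, hdvd⟩ := f.charpoly.exists_eq_pow_rootMultiplicity_mul_and_not_dvd
    f.charpoly_monic.ne_zero 0
  set r := f.charpoly.rootMultiplicity 0
  rw [Polynomial.C_0, sub_zero] at hq hdvd
  -- The exponent is `r + 1` and not `r` so that the polynomial defining `e` has no constant term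
  -- even when `r = 0`; its trace is then a combination of traces of positive powers. Modulo the
  -- characteristic polynomial `e` is idempotent, the projection onto the part where `f` is
  -- invertible.
  have hcop : IsCoprime (Polynomial.X ^ (r + 1)) q :=
    ((Polynomial.prime_X.irreducible.coprime_iff_not_dvd).2 hdvd).pow_left
  obtain ⟨a, b, hab⟩ := hcop
  have hker : Polynomial.aeval f (Polynomial.X ^ r * q) = 0 := by
    rw [← hq]; exact f.aeval_self_charpoly
  set e := Polynomial.aeval f (a * Polynomial.X ^ (r + 1)) with he
  have hidem : IsIdempotentElem e := by
    have : a * Polynomial.X ^ (r + 1) * (a * Polynomial.X ^ (r + 1))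
        = a * Polynomial.X ^ (r + 1) - (Polynomial.X ^ r * q) * (a * b * Polynomial.X) := by
      linear_combination (a * Polynomial.X ^ (r + 1)) * hab
    rw [IsIdempotentElem, he, ← map_mul, this, map_sub, map_mul _ (_ * q), hker, zero_mul, sub_zero]
  have he0 : e = 0 := by
    refine LinearMap.IsIdempotentElem.eq_zero_of_trace_eq_zero hidem ?_
    rw [he, pow_succ, ← mul_assoc]
    exact hX _
  refine ⟨r, ?_⟩
  have : Polynomial.X ^ r = Polynomial.X ^ r * (a * Polynomial.X ^ (r + 1)) +
      (Polynomial.X ^ r * q) * b := by linear_combination (-Polynomial.X ^ r) * hab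
  have h2 := congrArg (Polynomial.aeval f) this
  rwa [map_add, map_mul, map_mul _ _ b, hker, ← he, he0, mul_zero, zero_mul, add_zero, map_pow,
    Polynomial.aeval_X] at h2

/-- Burnside's theorem: a set of endomorphisms without common nontrivial invariant subspace
generates the full endomorphism algebra. -/
theorem adjoin_eq_top_of_irreducible [Nontrivial V] (s : Set (End ℂ V))
    (h : ∀ W : Submodule ℂ V, (∀ x ∈ s, ∀ v ∈ W, x v ∈ W) → W = ⊥ ∨ W = ⊤) :
    Algebra.adjoin ℂ s = ⊤ := by
  set A := Algebra.adjoin ℂ s with hA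
  have hsimple : IsSimpleModule A V := by
    rw [isSimpleModule_iff]
    refine { exists_pair_ne := ⟨⊥, ⊤, bot_ne_top⟩, eq_bot_or_eq_top := fun W => ?_ }
    have := h (W.restrictScalars ℂ) fun x hx v hv =>
      W.smul_mem (⟨x, Algebra.subset_adjoin hx⟩ : A) hv
    simpa using this
  rw [eq_top_iff]
  intro g _
  -- By Schur's lemma the commutant of `A` is ℂ, so any `g` is linear over it; the density theorem
  -- on a finite spanning set then realizes `g` by an element of `A`.
  have hcomm : ∀ φ : End A V, ∀ v, g (φ v) = φ (g v) := by
    intro φ v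
    obtain ⟨c, rfl⟩ := (IsSimpleModule.algebraMap_end_bijective_of_isAlgClosed (A := A) (V := V) ℂ).2 φ
    simp [Module.algebraMap_end_apply]
  let f : End (End A V) V :=
    { toFun := g, map_add' := map_add g, map_smul' := fun φ v => hcomm φ v }
  obtain ⟨t, ht⟩ := (Module.Finite.fg_top : (⊤ : Submodule ℂ V).FG)
  obtain ⟨r, hr⟩ := jacobson_density (R := A) f t
  have : g = r.1 := by
    exact LinearMap.ext_on ht fun v hv => hr v hv
  rw [this]
  exact r.2

theorem trace_mul_smulRight (f : End ℂ V) (φ : Dual ℂ V) (v : V) :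
    LinearMap.trace ℂ V (f * φ.smulRight v) = φ (f v) := by
  have : f * φ.smulRight v = φ.smulRight (f v) := by ext; simp
  rw [this, LinearMap.trace_smulRight]

theorem eq_zero_of_trace_mul_eq_zero (f : End ℂ V)
    (h : ∀ g : End ℂ V, LinearMap.trace ℂ V (f * g) = 0) : f = 0 := by
  ext v
  refine (Module.forall_dual_apply_eq_zero_iff ℂ (f v)).1 fun φ => ?_
  rw [← trace_mul_smulRight, h]

end Endomorphisms

/-! ### Words of fixed length and the algebras they generate -/

section Powers

variable {A : Type*} [Ring A] [Algebra ℂ A]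

theorem toSubmodule_adjoin_eq_iSup_pow (S : Submodule ℂ A) :
    Subalgebra.toSubmodule (Algebra.adjoin ℂ (S : Set A)) = ⨆ k : ℕ, S ^ k := by
  refine le_antisymm ?_ (iSup_le fun k => ?_)
  · intro x hx
    refine Algebra.adjoin_induction (p := fun y _ => y ∈ ⨆ k : ℕ, S ^ k) ?_ ?_ ?_ ?_ hx
    · intro y hy
      exact Submodule.mem_iSup_of_mem 1 (by simpa using hy)
    · intro c
      refine Submodule.mem_iSup_of_mem 0 ?_
      rw [pow_zero]
      exact Submodule.algebraMap_mem c
    · intro y z _ _ hy hz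
      exact add_mem hy hz
    · intro y z _ _ hy hz
      have := Submodule.mul_mem_mul hy hz
      rw [Submodule.iSup_mul] at this
      refine (iSup_le fun i => ?_ : _ ≤ ⨆ k : ℕ, S ^ k) this
      rw [Submodule.mul_iSup]
      refine iSup_le fun j => ?_
      rw [← pow_add]
      exact le_iSup (fun k => S ^ k) (i + j)
  · have hS : S ≤ Subalgebra.toSubmodule (Algebra.adjoin ℂ (S : Set A)) :=
      Algebra.subset_adjoin
    induction k with
    | zero =>
      rw [pow_zero, Submodule.one_le]
      exact one_mem (Algebra.adjoin ℂ (S : Set A))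
    | succ k ih =>
      rw [pow_succ, Submodule.mul_le]
      exact fun x hx y hy => (Algebra.adjoin ℂ (S : Set A)).mul_mem (ih hx) (hS hy)

/-- If `N * r` is nilpotent for all `r` generated by words of length divisible by `ℓ`, then
`N * w` is nilpotent for words `w` of any length. -/
theorem isNilpotent_mul_of_forall_adjoin_pow (S : Submodule ℂ A) {ℓ : ℕ} (hℓ : 1 ≤ ℓ) {N : A}
    (hN : N ∈ Algebra.adjoin ℂ ((S ^ ℓ : Submodule ℂ A) : Set A))
    (h : ∀ r ∈ Algebra.adjoin ℂ ((S ^ ℓ : Submodule ℂ A) : Set A), IsNilpotent (N * r))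
    {j : ℕ} {w : A} (hw : w ∈ S ^ j) : IsNilpotent (N * w) := by
  set B := Algebra.adjoin ℂ ((S ^ ℓ : Submodule ℂ A) : Set A) with hB
  set T := Subalgebra.toSubmodule B with hT
  have hTsup : T = ⨆ k : ℕ, (S ^ ℓ) ^ k := toSubmodule_adjoin_eq_iSup_pow _
  -- As `T` is the sum of powers of `S`, it commutes with `S ^ j` as a subspace, though not
  -- elementwise.
  have hcomm : Commute T (S ^ j) := by
    rw [hTsup, commute_iff_eq, Submodule.iSup_mul, Submodule.mul_iSup]
    refine iSup_congr fun k => ?_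
    rw [← pow_mul, ← pow_add, ← pow_add, add_comm]
  have hTT : T * T = T := B.isIdempotentElem_toSubmodule
  have hpow : ∀ l, T ^ (l + 1) = T := by
    intro l
    induction l with
    | zero => exact pow_one T
    | succ l ih => rw [pow_succ, ih, hTT]
  obtain ⟨l, rfl⟩ : ∃ l, ℓ = l + 1 := ⟨ℓ - 1, by omega⟩
  have hmem : w * (N * w) ^ l ∈ T := by
    -- With `ℓ = l + 1` this product contains `ℓ` copies of `w`. Once collected, they contribute
    -- words of length `j * ℓ`, which lie in `T`.
    have h1 : w * (N * w) ^ l ∈ S ^ j * (T * S ^ j) ^ l :=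
      Submodule.mul_mem_mul hw (Submodule.pow_mem_pow _ (Submodule.mul_mem_mul hN hw) l)
    rw [hcomm.mul_pow, ← mul_assoc, ← (hcomm.pow_left l).eq, mul_assoc, ← pow_succ', ← pow_mul,
      mul_comm j, pow_mul] at h1
    have h2 : (S ^ (l + 1)) ^ j ≤ T := by rw [hTsup]; exact le_iSup (fun k => (S ^ (l + 1)) ^ k) j
    have h3 := mul_le_mul' (le_refl (T ^ l)) h2 h1
    rwa [← pow_succ, hpow] at h3
  have : (N * w) ^ (l + 1) = N * (w * (N * w) ^ l) := by rw [pow_succ', mul_assoc]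
  exact IsNilpotent.of_pow (m := l + 1) (this ▸ h _ hmem)

end Powers

/-! ### Restriction to invariant subspaces -/

section Restriction

variable {V : Type*} [AddCommGroup V] [Module ℂ V]

/-- The endomorphisms leaving a subspace invariant. -/
def stabilizer (U : Submodule ℂ V) : Subalgebra ℂ (End ℂ V) where
  carrier := {x | ∀ v ∈ U, x v ∈ U}
  mul_mem' hx hy v hv := hx _ (hy v hv)
  add_mem' hx hy v hv := add_mem (hx v hv) (hy v hv)
  algebraMap_mem' c v hv := by
    rw [Module.algebraMap_end_apply]; exact U.smul_mem c hv

/-- Restriction of endomorphisms to an invariant subspace. -/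
def restrictHom (U : Submodule ℂ V) : stabilizer U →ₐ[ℂ] End ℂ U where
  toFun x := x.1.restrict x.2
  map_one' := rfl
  map_mul' _ _ := rfl
  map_zero' := rfl
  map_add' _ _ := rfl
  commutes' _ := rfl

/-- The subspace `U` is irreducible under the operators in `S`. -/
structure IsIrreducibleOn (S : Submodule ℂ (End ℂ V)) (U : Submodule ℂ V) : Prop where
  ne_bot : U ≠ ⊥
  invariant : ∀ x ∈ S, x ∈ stabilizer U
  eq_bot_or_eq : ∀ W ≤ U, (∀ x ∈ S, x ∈ stabilizer W) → W = ⊥ ∨ W = U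

end Restriction

/-! ### The vanishing principle and semisimplicity after blocking -/

section Semisimple

variable {V : Type*} [AddCommGroup V] [Module ℂ V] [FiniteDimensional ℂ V]

theorem map_val_comap_pow {A : Type*} [Ring A] [Algebra ℂ A] {B : Subalgebra ℂ A}
    {S : Submodule ℂ A} (h : S ≤ Subalgebra.toSubmodule B) (k : ℕ) :
    ((S.comap B.val.toLinearMap) ^ k).map B.val.toLinearMap = S ^ k := by
  rw [Submodule.map_pow, Submodule.map_comap_eq_of_le]
  intro x hx
  exact ⟨⟨x, h hx⟩, rfl⟩

/-- If `ρ x` multiplies all words into nilpotents, and the words act without nontrivial invariant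
subspace, then `ρ x = 0`. -/
theorem map_eq_zero_of_isNilpotent_mul {A : Type*} [Ring A] [Algebra ℂ A]
    (ρ : A →ₐ[ℂ] End ℂ V) (S : Submodule ℂ A)
    (hS : Algebra.adjoin ℂ (S.map ρ.toLinearMap : Set (End ℂ V)) = ⊤) {N : A}
    (h : ∀ j, ∀ w ∈ S ^ j, LinearMap.trace ℂ V (ρ (N * w)) = 0) : ρ N = 0 := by
  refine eq_zero_of_trace_mul_eq_zero _ fun g => ?_
  have hg : g ∈ Subalgebra.toSubmodule
      (Algebra.adjoin ℂ (S.map ρ.toLinearMap : Set (End ℂ V))) := by rw [hS]; trivial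
  rw [toSubmodule_adjoin_eq_iSup_pow] at hg
  refine (iSup_le fun j => ?_ : _ ≤ LinearMap.ker
    (LinearMap.trace ℂ V ∘ₗ LinearMap.mulLeft ℂ (ρ N))) hg
  rw [← Submodule.map_pow]
  rintro _ ⟨w, hw, rfl⟩
  have := h j w hw
  rw [map_mul] at this
  simpa using this

theorem IsIrreducibleOn.adjoin_eq_top {S : Submodule ℂ (End ℂ V)} {U : Submodule ℂ V}
    (hU : IsIrreducibleOn S U) :
    Algebra.adjoin ℂ ((S.comap (stabilizer U).val.toLinearMap).map (restrictHom U).toLinearMap :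
      Set (End ℂ U)) = ⊤ := by
  have : Nontrivial U := Submodule.nontrivial_iff_ne_bot.2 hU.ne_bot
  refine adjoin_eq_top_of_irreducible _ fun W hW => ?_
  have hle : W.map U.subtype ≤ U := Submodule.map_subtype_le U W
  have hinv : ∀ x ∈ S, x ∈ stabilizer (W.map U.subtype) := by
    rintro x hx _ ⟨v, hv, rfl⟩
    exact ⟨_, hW _ ⟨⟨x, hU.invariant x hx⟩, hx, rfl⟩ v hv, rfl⟩
  rcases hU.eq_bot_or_eq (W.map U.subtype) hle hinv with h | h
  · left
    refine Submodule.map_injective_of_injective U.injective_subtype ?_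
    rw [h, Submodule.map_bot]
  · right
    refine Submodule.map_injective_of_injective U.injective_subtype ?_
    rw [h, Submodule.map_subtype_top]

/-- Restricting a nilpotent operator to `U` leaves it nilpotent, hence traceless. So the restriction
of `N` is orthogonal, for the trace form, to all words on `U`, and these span `End ℂ U` by Burnside.
-/
theorem IsIrreducibleOn.eq_zero_of_isNilpotent_mul {S : Submodule ℂ (End ℂ V)} {U : Submodule ℂ V}
    (hU : IsIrreducibleOn S U) {N : End ℂ V} (hN : N ∈ stabilizer U)
    (h : ∀ j, ∀ w ∈ S ^ j, IsNilpotent (N * w)) : ∀ v ∈ U, N v = 0 := by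
  have := map_eq_zero_of_isNilpotent_mul (restrictHom U) _ hU.adjoin_eq_top (N := ⟨N, hN⟩)
    fun j w hw => by
      have hw' : (w : End ℂ V) ∈ S ^ j := by
        rw [← map_val_comap_pow (B := stabilizer U) hU.invariant j]
        exact ⟨w, hw, rfl⟩
      have hnil : IsNilpotent (⟨N, hN⟩ * w : stabilizer U) := by
        obtain ⟨k, hk⟩ := h j w hw'
        exact ⟨k, Subtype.ext hk⟩
      exact (LinearMap.isNilpotent_trace_of_isNilpotent (hnil.map (restrictHom U))).eq_zero
  intro v hv
  have h2 := congrArg (fun f : End ℂ U => (f ⟨v, hv⟩ : V)) this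
  exact h2

variable {κ : Type*} {S : Submodule ℂ (End ℂ V)} {U : κ → Submodule ℂ V}

/-- The subspaces need only span `V`; directness of the sum plays no role, since the kernel of `N`
contains each of them. -/
theorem eq_zero_of_isNilpotent_mul (hU : ∀ k, IsIrreducibleOn S (U k)) (htop : ⨆ k, U k = ⊤)
    {N : End ℂ V} (hN : ∀ k, N ∈ stabilizer (U k))
    (h : ∀ j, ∀ w ∈ S ^ j, IsNilpotent (N * w)) : N = 0 := by
  have : (⊤ : Submodule ℂ V) ≤ LinearMap.ker N := by
    rw [← htop]
    exact iSup_le fun k v hv => (hU k).eq_zero_of_isNilpotent_mul (hN k) h v hv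
  ext v
  exact this trivial

omit [FiniteDimensional ℂ V] in
theorem adjoin_pow_le_stabilizer {U : Submodule ℂ V} (hU : ∀ x ∈ S, x ∈ stabilizer U) (ℓ : ℕ) :
    Algebra.adjoin ℂ ((S ^ ℓ : Submodule ℂ (End ℂ V)) : Set (End ℂ V)) ≤ stabilizer U := by
  refine Algebra.adjoin_le ?_
  rw [← map_val_comap_pow (B := stabilizer U) hU ℓ]
  rintro _ ⟨x, _, rfl⟩
  exact x.2

/-- Irreducibility is assumed for unblocked words, nilpotency is tested only on blocked ones; the
counting argument in `isNilpotent_mul_of_forall_adjoin_pow` bridges the two. -/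
theorem eq_zero_of_isNilpotent_mul_adjoin_pow (hU : ∀ k, IsIrreducibleOn S (U k))
    (htop : ⨆ k, U k = ⊤) {ℓ : ℕ} (hℓ : 1 ≤ ℓ) {N : End ℂ V}
    (hN : N ∈ Algebra.adjoin ℂ ((S ^ ℓ : Submodule ℂ (End ℂ V)) : Set (End ℂ V)))
    (h : ∀ r ∈ Algebra.adjoin ℂ ((S ^ ℓ : Submodule ℂ (End ℂ V)) : Set (End ℂ V)),
      IsNilpotent (N * r)) : N = 0 :=
  eq_zero_of_isNilpotent_mul hU htop
    (fun k => adjoin_pow_le_stabilizer (hU k).invariant ℓ hN)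
    fun _ _ hw => isNilpotent_mul_of_forall_adjoin_pow S hℓ hN h hw

/-- Subspaces invariant under all words of a fixed length have invariant complements. -/
theorem exists_isCompl_invariant (hU : ∀ k, IsIrreducibleOn S (U k))
    (htop : ⨆ k, U k = ⊤) {ℓ : ℕ} (hℓ : 1 ≤ ℓ) (W : Submodule ℂ V)
    (hW : ∀ x ∈ S ^ ℓ, x ∈ stabilizer W) :
    ∃ W' : Submodule ℂ V, (∀ x ∈ S ^ ℓ, x ∈ stabilizer W') ∧ IsCompl W W' := by
  set B := Algebra.adjoin ℂ ((S ^ ℓ : Submodule ℂ (End ℂ V)) : Set (End ℂ V)) with hB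
  have hart : IsArtinianRing B := IsArtinianRing.of_finite ℂ B
  have hss : IsSemisimpleRing B := by
    rw [IsArtinianRing.isSemisimpleRing_iff_jacobson, eq_bot_iff]
    intro N hN
    -- The radical of an Artinian ring is a nilpotent ideal, so the vanishing principle applies to
    -- each of its elements.
    have hnil : ∀ r : B, IsNilpotent (N * r) := by
      intro r
      obtain ⟨k, hk⟩ := IsSemiprimaryRing.isNilpotent (R := B)
      refine ⟨k, ?_⟩
      have : (N * r) ^ k ∈ Ring.jacobson B ^ k :=
        Ideal.pow_mem_pow (Ideal.mul_mem_right _ _ hN) k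
      rw [hk] at this
      simpa using this
    have := eq_zero_of_isNilpotent_mul_adjoin_pow hU htop hℓ N.2 fun r hr => by
      obtain ⟨k, hk⟩ := hnil ⟨r, hr⟩
      exact ⟨k, congrArg Subtype.val hk⟩
    exact (Submodule.mem_bot B).2 (Subtype.ext this)
  have hBW : B ≤ stabilizer W := Algebra.adjoin_le hW
  let W₀ : Submodule B V :=
    { W.toAddSubmonoid with smul_mem' := fun x v hv => hBW x.2 v hv }
  obtain ⟨W₁, hW₁⟩ := exists_isCompl W₀
  refine ⟨W₁.restrictScalars ℂ, fun x hx v hv => ?_, ?_⟩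
  · exact W₁.smul_mem (⟨x, Algebra.subset_adjoin hx⟩ : B) hv
  · rw [isCompl_iff, Submodule.disjoint_def, codisjoint_iff] at hW₁ ⊢
    refine ⟨hW₁.1, ?_⟩
    rw [eq_top_iff]
    intro v _
    have : v ∈ W₀ ⊔ W₁ := by rw [hW₁.2]; trivial
    obtain ⟨a, ha, b, hb, hab⟩ := Submodule.mem_sup.1 this
    exact Submodule.mem_sup.2 ⟨a, ha, b, hb, hab⟩

end Semisimple

/-! ### Splitting into totally irreducible subspaces -/

section Decomposition

variable {V : Type*} [AddCommGroup V] [Module ℂ V] [FiniteDimensional ℂ V]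
  {S : Submodule ℂ (End ℂ V)}

/-- The subspace is invariant, and irreducible under words of length `m` for all `m ≥ 1`. -/
def IsTotallyIrreducibleOn (S : Submodule ℂ (End ℂ V)) (U : Submodule ℂ V) : Prop :=
  ∀ m, 1 ≤ m → IsIrreducibleOn (S ^ m) U

omit [FiniteDimensional ℂ V] in
theorem IsTotallyIrreducibleOn.pow {U : Submodule ℂ V} (h : IsTotallyIrreducibleOn S U) {t : ℕ}
    (ht : 1 ≤ t) : IsTotallyIrreducibleOn (S ^ t) U := fun m hm => by
  rw [← pow_mul S]; exact h _ (Nat.mul_pos ht hm)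

omit [FiniteDimensional ℂ V] in
theorem mem_stabilizer_of_mem_pow {U : Submodule ℂ V} (hU : ∀ x ∈ S, x ∈ stabilizer U) (m : ℕ) :
    ∀ x ∈ S ^ m, x ∈ stabilizer U := fun _ hx =>
  adjoin_pow_le_stabilizer hU m (Algebra.subset_adjoin hx)

/-- If `U` fails to be totally irreducible, some further blocking has a proper invariant subspace,
which splits off by complementability; both pieces have smaller dimension. The dimension count
records that the resulting sum is direct. -/
theorem exists_totallyIrreducible_decomposition
    (hS : ∀ ℓ, 1 ≤ ℓ → ∀ W : Submodule ℂ V, (∀ x ∈ S ^ ℓ, x ∈ stabilizer W) →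
      ∃ W' : Submodule ℂ V, (∀ x ∈ S ^ ℓ, x ∈ stabilizer W') ∧ IsCompl W W')
    (d : ℕ) : ∀ (U : Submodule ℂ V) (L : ℕ), 1 ≤ L → (∀ x ∈ S ^ L, x ∈ stabilizer U) →
      finrank ℂ U ≤ d → ∃ t, 1 ≤ t ∧ ∃ (N : ℕ) (W : Fin N → Submodule ℂ V), ⨆ a, W a = U ∧
        ∑ a, finrank ℂ (W a) = finrank ℂ U ∧ ∀ a, IsTotallyIrreducibleOn (S ^ (L * t)) (W a) := by
  induction d with
  | zero =>
    intro U L _ _ hd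
    have hU : U = ⊥ := Submodule.finrank_eq_zero.1 (Nat.le_zero.1 hd)
    subst hU
    exact ⟨1, le_rfl, 0, Fin.elim0, by simp, by simp, fun a => a.elim0⟩
  | succ d ih =>
    intro U L hL hinv hd
    by_cases hbot : U = ⊥
    · subst hbot
      exact ⟨1, le_rfl, 0, Fin.elim0, by simp, by simp, fun a => a.elim0⟩
    by_cases htot : IsTotallyIrreducibleOn (S ^ L) U
    · exact ⟨1, le_rfl, 1, fun _ => U, by simp, by simp, fun _ => by rwa [mul_one]⟩
    have : ∃ m, 1 ≤ m ∧ ∃ U₁ ≤ U, (∀ x ∈ (S ^ L) ^ m, x ∈ stabilizer U₁) ∧ U₁ ≠ ⊥ ∧ U₁ ≠ U := by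
      by_contra hcon
      refine htot fun m hm => ⟨hbot, mem_stabilizer_of_mem_pow hinv m, fun W hW hWinv => ?_⟩
      by_contra hne
      rw [not_or] at hne
      exact hcon ⟨m, hm, W, hW, hWinv, hne.1, hne.2⟩
    obtain ⟨m, hm, U₁, hle, hinv₁, hne₁, hne₁'⟩ := this
    rw [← pow_mul S] at hinv₁
    have hLm : 1 ≤ L * m := Nat.mul_pos hL hm
    obtain ⟨C, hC, hcompl⟩ := hS (L * m) hLm U₁ hinv₁
    set U₂ := C ⊓ U with hU₂
    have hinv₂ : ∀ x ∈ S ^ (L * m), x ∈ stabilizer U₂ := fun x hx v hv =>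
      ⟨hC x hx v hv.1, mem_stabilizer_of_mem_pow hinv m x (by rwa [← pow_mul S]) v hv.2⟩
    have hsup : U₁ ⊔ U₂ = U := by
      rw [hU₂, ← sup_inf_assoc_of_le C hle, hcompl.sup_eq_top, top_inf_eq]
    have hinf : U₁ ⊓ U₂ = ⊥ := by
      rw [hU₂, ← inf_assoc, hcompl.inf_eq_bot, bot_inf_eq]
    have hdim : finrank ℂ U₁ + finrank ℂ U₂ = finrank ℂ U := by
      rw [← Submodule.finrank_sup_add_finrank_inf_eq, hsup, hinf, finrank_bot, add_zero]
    have hlt₁ : finrank ℂ U₁ < finrank ℂ U :=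
      Submodule.finrank_lt_finrank_of_lt (lt_of_le_of_ne hle hne₁')
    have hpos₁ : finrank ℂ U₁ ≠ 0 := fun h => hne₁ (Submodule.finrank_eq_zero.1 h)
    obtain ⟨t₁, ht₁, N₁, W₁, hW₁, hd₁, hT₁⟩ := ih U₁ (L * m) hLm hinv₁ (by omega)
    -- The second piece starts from the length already reached for the first, so one final length
    -- serves both: total irreducibility persists under further blocking.
    obtain ⟨t₂, ht₂, N₂, W₂, hW₂, hd₂, hT₂⟩ := ih U₂ (L * m * t₁) (Nat.mul_pos hLm ht₁)
      (fun x hx => mem_stabilizer_of_mem_pow hinv₂ t₁ x (by rwa [← pow_mul S])) (by omega)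
    refine ⟨m * t₁ * t₂, Nat.mul_pos (Nat.mul_pos hm ht₁) ht₂, N₁ + N₂, Fin.append W₁ W₂,
      ?_, ?_, ?_⟩
    · have h := finSumFinEquiv.iSup_comp (g := Fin.append W₁ W₂)
      rw [iSup_sum] at h
      simp only [finSumFinEquiv_apply_left, finSumFinEquiv_apply_right, Fin.append_left,
        Fin.append_right] at h
      rw [← h, hW₁, hW₂, hsup]
    · rw [Fin.sum_univ_add, ← hdim, ← hd₁, ← hd₂]
      exact congrArg₂ _ (Finset.sum_congr rfl fun i _ => by rw [Fin.append_left])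
        (Finset.sum_congr rfl fun i _ => by rw [Fin.append_right])
    · intro a
      have h1 : L * (m * t₁ * t₂) = L * m * t₁ * t₂ := by ring
      rw [h1]
      refine Fin.addCases (fun i => ?_) (fun i => ?_) a
      · rw [Fin.append_left, pow_mul S (L * m * t₁)]
        exact (hT₁ i).pow ht₂
      · rw [Fin.append_right]
        exact hT₂ i

end Decomposition

/-! ### Words of one length span the full matrix algebra -/

section SingleBlock

variable {V : Type*} [AddCommGroup V] [Module ℂ V] [FiniteDimensional ℂ V]

theorem eq_zero_of_trace_mul_pow_eq_zero {F : Submodule ℂ (End ℂ V)}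
    (hF : Algebra.adjoin ℂ (F : Set (End ℂ V)) = ⊤) {x : End ℂ V}
    (h : ∀ j, ∀ w ∈ F ^ j, LinearMap.trace ℂ V (x * w) = 0) : x = 0 := by
  refine map_eq_zero_of_isNilpotent_mul (AlgHom.id ℂ (End ℂ V)) F ?_ h
  convert hF
  exact Submodule.map_id F

/-- The full endomorphism algebra is simple. -/
theorem top_mul_span_singleton_mul_top {p : End ℂ V} (hp : p ≠ 0) :
    (⊤ : Submodule ℂ (End ℂ V)) * Submodule.span ℂ {p} * ⊤ = ⊤ := by
  rw [eq_top_iff]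
  intro g _
  obtain ⟨v, hv⟩ : ∃ v, p v ≠ 0 := by
    by_contra hcon
    push Not at hcon
    exact hp (LinearMap.ext hcon)
  obtain ⟨φ, hφ⟩ := Module.Projective.exists_dual_eq_one ℂ hv
  let b := Module.finBasis ℂ V
  -- As `φ (p v) = 1`, the `i`-th summand is the rank-one map sending `b i` to `g (b i)` and the
  -- other basis vectors to zero.
  have hg : g = ∑ i, φ.smulRight (g (b i)) * p * (b.coord i).smulRight v := by
    refine b.ext fun k => ?_
    simp only [LinearMap.sum_apply, Module.End.mul_apply, LinearMap.smulRight_apply, map_smul,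
      Basis.coord_apply, Basis.repr_self, hφ, one_smul]
    rw [Finset.sum_eq_single k]
    · simp
    · intro i _ hi
      simp [Finsupp.single_eq_of_ne hi]
    · simp
  rw [hg]
  exact sum_mem fun i _ => Submodule.mul_mem_mul
    (Submodule.mul_mem_mul trivial (Submodule.mem_span_singleton_self p)) trivial

/-- Otherwise an element of `F` would have traceless products with all words, hence be zero by
nondegeneracy. -/
theorem exists_not_isNilpotent_mem_pow {F : Submodule ℂ (End ℂ V)}
    (hF : Algebra.adjoin ℂ (F : Set (End ℂ V)) = ⊤) (hne : F ≠ ⊥) :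
    ∃ ℓ, 1 ≤ ℓ ∧ ∃ x ∈ F ^ ℓ, ¬ IsNilpotent x := by
  by_contra hcon
  push Not at hcon
  refine hne (eq_bot_iff.2 fun x hx => ?_)
  refine (Submodule.mem_bot ℂ).2 (eq_zero_of_trace_mul_pow_eq_zero hF fun j w hw => ?_)
  have : x * w ∈ F ^ (j + 1) := by
    rw [pow_succ' F]
    exact Submodule.mul_mem_mul hx hw
  exact (LinearMap.isNilpotent_trace_of_isNilpotent (hcon _ (Nat.le_add_left 1 j) _ this)).eq_zero

/-- A graded irreducible algebra contains a homogeneous idempotent of positive degree. -/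
theorem exists_idempotent_mem_pow {F : Submodule ℂ (End ℂ V)}
    (hF : ∀ m, 1 ≤ m → Algebra.adjoin ℂ ((F ^ m : Submodule ℂ (End ℂ V)) : Set (End ℂ V)) = ⊤)
    (hne : F ≠ ⊥) : ∃ ℓ, 1 ≤ ℓ ∧ ∃ p ∈ F ^ ℓ, p * p = p ∧ p ≠ 0 := by
  classical
  have hex : ∃ r, ∃ ℓ, 1 ≤ ℓ ∧ ∃ x ∈ F ^ ℓ, ¬ IsNilpotent x ∧
      finrank ℂ (LinearMap.range x) = r := by
    obtain ⟨ℓ, hℓ, x, hx, hn⟩ := exists_not_isNilpotent_mem_pow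
      (by simpa only [pow_one] using hF 1 le_rfl) hne
    exact ⟨_, ℓ, hℓ, x, hx, hn, rfl⟩
  obtain ⟨ℓ, hℓ, x, hx, hn, hr⟩ := Nat.find_spec hex
  have hmin : ∀ k, 1 ≤ k → ∀ y ∈ F ^ k,
      finrank ℂ (LinearMap.range y) < finrank ℂ (LinearMap.range x) → IsNilpotent y := by
    intro k hk y hy hlt
    by_contra hny
    rw [hr] at hlt
    exact Nat.find_min hex hlt ⟨k, hk, y, hy, hny, rfl⟩
  clear hr
  set U := LinearMap.range x with hU
  have hxU : ∀ v ∈ U, x v ∈ U := fun v _ => ⟨v, rfl⟩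
  -- The rank of `x` is minimal among non-nilpotent elements homogeneous of positive length. If `x`
  -- were not injective on its range, `x * x` would have smaller rank, hence be nilpotent, and so
  -- would `x`.
  have hker : ∀ u ∈ U, x u = 0 → u = 0 := by
    have hsq : U ≤ LinearMap.range (x * x) := by
      have hle : LinearMap.range (x * x) ≤ U := by
        rintro _ ⟨v, rfl⟩; exact ⟨x v, rfl⟩
      refine (Submodule.eq_of_le_of_finrank_le hle ?_).ge
      by_contra hlt
      rw [not_le] at hlt
      have := hmin (ℓ + ℓ) (by omega) (x * x)
        (by rw [pow_add F]; exact Submodule.mul_mem_mul hx hx) hlt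
      rw [← pow_two] at this
      exact hn (IsNilpotent.of_pow this)
    have hsurj : Function.Surjective (x.restrict hxU) := by
      rintro ⟨u, hu⟩
      obtain ⟨v, hv⟩ := hsq hu
      exact ⟨⟨x v, v, rfl⟩, Subtype.ext hv⟩
    have hinj := LinearMap.injective_iff_surjective.2 hsurj
    intro u hu h0
    have := hinj (a₁ := ⟨u, hu⟩) (a₂ := 0) (by rw [map_zero]; exact Subtype.ext h0)
    exact congrArg Subtype.val this
  set X : End ℂ U := x.restrict hxU with hX
  have hXinj : Function.Injective X := by
    rw [← LinearMap.ker_eq_bot, LinearMap.ker_eq_bot']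
    intro u hu
    exact Subtype.ext (hker u u.2 (congrArg Subtype.val hu))
  have hXunit : IsUnit X := (LinearMap.isUnit_iff_ker_eq_bot X).2 (LinearMap.ker_eq_bot.2 hXinj)
  have hUnt : Nontrivial U := by
    rw [Submodule.nontrivial_iff_ne_bot]
    intro h0
    rw [hU, LinearMap.range_eq_bot] at h0
    exact hn (h0 ▸ IsNilpotent.zero)
  have hXpow : ∀ (k : ℕ) (u : U), ((X ^ k) u : V) = (x ^ k) u := by
    intro k
    induction k with
    | zero => intro u; rfl
    | succ k ih => intro u; rw [pow_succ, pow_succ]; exact ih (X u)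
  set G := F ^ ℓ with hG
  have hGtop : ⨆ k : ℕ, G ^ k = ⊤ := by
    rw [← toSubmodule_adjoin_eq_iSup_pow, hF ℓ hℓ, Algebra.top_toSubmodule]
  -- The constant is an eigenvalue of `x * z` relative to `x ^ (m + 1)` on the range of `x`. The
  -- difference `y` of the two sides is homogeneous and kills `ker x` together with a vector outside
  -- it, so it has smaller rank than `x`. The same holds for all `y * w`, which are therefore
  -- nilpotent, and `y = 0` follows from the trace form.
  have hkey : ∀ m, ∀ z ∈ G ^ m, ∃ c : ℂ, x * z * x = c • x ^ (m + 2) := by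
    intro m z hz
    let B : End ℂ U := (x * z).restrict (p := U) (q := U) fun v _ => ⟨z v, rfl⟩
    obtain ⟨Y, hY⟩ := hXunit.pow (m + 1)
    obtain ⟨c, hc⟩ := Module.End.exists_eigenvalue (Y⁻¹.val * B)
    obtain ⟨u, hu⟩ := hc.exists_hasEigenvector
    have hBu : B u = c • (X ^ (m + 1)) u := by
      have h1 : (Y⁻¹.val * B) u = c • u := hu.apply_eq_smul
      have h2 := congrArg Y.val h1
      rw [← Module.End.mul_apply, ← mul_assoc, Units.mul_inv, one_mul, map_smul, hY] at h2
      exact h2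
    obtain ⟨v, hv⟩ : ∃ v, x v = u := u.2
    have hxv : x v ≠ 0 := fun h0 => hu.2 (Subtype.ext (hv ▸ h0))
    refine ⟨c, ?_⟩
    set y := x * z * x - c • x ^ (m + 2) with hy
    have hyv : y v = 0 := by
      have h1 : x (z (u : V)) = c • (x ^ (m + 1)) u := by
        rw [← hXpow]; exact congrArg Subtype.val hBu
      rw [hy, LinearMap.sub_apply, LinearMap.smul_apply, pow_succ x (m + 1), Module.End.mul_apply,
        Module.End.mul_apply, Module.End.mul_apply, hv, h1, sub_self]
    have hyG : y ∈ G ^ (m + 2) := by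
      have hx2 : x ^ (m + 2) ∈ G ^ (m + 2) := Submodule.pow_mem_pow G hx (m + 2)
      refine sub_mem ?_ (Submodule.smul_mem _ c hx2)
      rw [pow_succ G, pow_succ' G]
      exact Submodule.mul_mem_mul (Submodule.mul_mem_mul hx hz) hx
    have hrank : finrank ℂ (LinearMap.range y) < finrank ℂ U := by
      have hlt : LinearMap.ker x < LinearMap.ker y := by
        refine lt_of_le_of_ne (fun t ht => ?_) fun heq => ?_
        · rw [LinearMap.mem_ker] at ht ⊢
          rw [hy, LinearMap.sub_apply, LinearMap.smul_apply, pow_succ x (m + 1),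
            Module.End.mul_apply, Module.End.mul_apply, ht, map_zero,
            Module.End.mul_apply, ht, map_zero, map_zero, smul_zero, sub_zero]
        · exact hxv (LinearMap.mem_ker.1 (heq ▸ LinearMap.mem_ker.2 hyv))
      have h1 := Submodule.finrank_lt_finrank_of_lt hlt
      have h2 := LinearMap.finrank_range_add_finrank_ker x
      have h3 := LinearMap.finrank_range_add_finrank_ker y
      rw [← hU] at h2
      omega
    refine sub_eq_zero.1 (eq_zero_of_trace_mul_pow_eq_zero (hF ℓ hℓ) fun j w hw => ?_)
    have hmem : y * w ∈ F ^ (ℓ * (m + 2 + j)) := by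
      rw [pow_mul F, pow_add (F ^ ℓ)]
      exact Submodule.mul_mem_mul hyG hw
    refine (LinearMap.isNilpotent_trace_of_isNilpotent
      (hmin _ (Nat.mul_pos hℓ (by omega)) _ hmem (lt_of_le_of_lt ?_ hrank))).eq_zero
    refine Submodule.finrank_mono ?_
    rintro _ ⟨t, rfl⟩
    exact ⟨w t, rfl⟩
  have hcomm : ∀ z, x * (x * z * x) = x * z * x * x := by
    let K : Submodule ℂ (End ℂ V) := LinearMap.ker
      (LinearMap.mulLeft ℂ x ∘ₗ LinearMap.mulLeft ℂ x ∘ₗ LinearMap.mulRight ℂ x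
        - LinearMap.mulRight ℂ x ∘ₗ LinearMap.mulRight ℂ x ∘ₗ LinearMap.mulLeft ℂ x)
    have hK : (⊤ : Submodule ℂ (End ℂ V)) ≤ K := by
      rw [← hGtop]
      refine iSup_le fun m z hz => ?_
      obtain ⟨c, hc⟩ := hkey m z hz
      rw [LinearMap.mem_ker, LinearMap.sub_apply, sub_eq_zero]
      change x * (x * (z * x)) = x * z * x * x
      rw [← mul_assoc x z x, hc, mul_smul_comm, smul_mul_assoc, ← pow_succ', ← pow_succ]
    intro z
    have := hK (Submodule.mem_top (x := z))
    rw [LinearMap.mem_ker, LinearMap.sub_apply, sub_eq_zero] at this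
    rw [mul_assoc x z x]
    exact this
  obtain ⟨c, hc⟩ := Module.End.exists_eigenvalue X
  obtain ⟨u, hu⟩ := hc.exists_hasEigenvector
  have hu0 : (u : V) ≠ 0 := fun h0 => hu.2 (Subtype.ext h0)
  have hxu : x u = c • (u : V) := congrArg Subtype.val hu.apply_eq_smul
  have hc0 : c ≠ 0 := by
    rintro rfl
    rw [zero_smul] at hxu
    exact hu0 (hker u u.2 hxu)
  -- Evaluating `hcomm` for a rank-one `z` at an eigenvector of `x` gives `c • x (x w) = c ^ 2 • x
  -- w` for arbitrary `w`.
  have hsq : x * x = c • x := by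
    ext w
    obtain ⟨φ, hφ⟩ := Module.Projective.exists_dual_eq_one ℂ hu0
    have := congrArg (fun f : End ℂ V => f u) (hcomm (φ.smulRight w))
    simp only [Module.End.mul_apply, LinearMap.smulRight_apply, hxu, map_smul, hφ, smul_smul,
      mul_one] at this
    rw [mul_smul] at this
    exact smul_right_injective V hc0 this
  refine ⟨ℓ, hℓ, c⁻¹ • x, Submodule.smul_mem _ _ hx, ?_, ?_⟩
  · rw [smul_mul_smul_comm, hsq, smul_smul, mul_assoc, inv_mul_cancel₀ hc0, mul_one]
  · intro h0
    rcases smul_eq_zero.1 h0 with h | h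
    · exact inv_ne_zero hc0 h
    · exact hn (h ▸ IsNilpotent.zero)

/-- Quantum Wielandt property: if words of length divisible by `m` generate the full endomorphism
algebra for every `m`, then words of some fixed length span it. -/
theorem exists_pow_eq_top {F : Submodule ℂ (End ℂ V)}
    (hF : ∀ m, 1 ≤ m → Algebra.adjoin ℂ ((F ^ m : Submodule ℂ (End ℂ V)) : Set (End ℂ V)) = ⊤)
    (hne : F ≠ ⊥) : ∃ ℓ, 1 ≤ ℓ ∧ F ^ ℓ = ⊤ := by
  obtain ⟨ℓ, hℓ, p, hp, hpp, hp0⟩ := exists_idempotent_mem_pow hF hne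
  set G := F ^ ℓ with hG
  have hGtop : ⨆ k : ℕ, G ^ k = ⊤ := by
    rw [← toSubmodule_adjoin_eq_iSup_pow, hF ℓ hℓ, Algebra.top_toSubmodule]
  set P : Submodule ℂ (End ℂ V) := Submodule.span ℂ {p} with hP
  have hPP : P * P = P := by
    rw [hP, Submodule.span_mul_span, Set.singleton_mul_singleton, hpp]
  have hPG : P ≤ G := (Submodule.span_singleton_le_iff_mem p G).2 hp
  -- The powers of `G` need not increase, but multiplied by `P` they do, because `P = P * P` and `P
  -- ≤ G`. The chain stabilizes at its supremum by finite dimension.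
  have hl : ∃ k, G ^ k * P = ⊤ * P := by
    let f : ℕ →o Submodule ℂ (End ℂ V) := ⟨fun k => G ^ k * P, monotone_nat_of_le_succ fun k => by
      calc G ^ k * P = G ^ k * (P * P) := by rw [hPP]
        _ ≤ G ^ k * (G * P) := mul_le_mul' le_rfl (mul_le_mul' hPG le_rfl)
        _ = G ^ (k + 1) * P := by rw [pow_succ G, mul_assoc]⟩
    obtain ⟨k, hk⟩ := monotone_stabilizes_iff_noetherian.2 inferInstance f
    refine ⟨k, ?_⟩
    rw [← hGtop, Submodule.iSup_mul]
    refine le_antisymm (le_iSup (fun k => G ^ k * P) k) (iSup_le fun i => ?_)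
    calc G ^ i * P ≤ f (max k i) := f.monotone (le_max_right k i)
      _ = G ^ k * P := (hk _ (le_max_left k i)).symm
  have hr : ∃ k, P * G ^ k = P * ⊤ := by
    let f : ℕ →o Submodule ℂ (End ℂ V) := ⟨fun k => P * G ^ k, monotone_nat_of_le_succ fun k => by
      calc P * G ^ k = (P * P) * G ^ k := by rw [hPP]
        _ ≤ (P * G) * G ^ k := mul_le_mul' (mul_le_mul' le_rfl hPG) le_rfl
        _ = P * G ^ (k + 1) := by rw [pow_succ' G, mul_assoc]⟩
    obtain ⟨k, hk⟩ := monotone_stabilizes_iff_noetherian.2 inferInstance f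
    refine ⟨k, ?_⟩
    rw [← hGtop, Submodule.mul_iSup]
    refine le_antisymm (le_iSup (fun k => P * G ^ k) k) (iSup_le fun i => ?_)
    calc P * G ^ i ≤ f (max k i) := f.monotone (le_max_right k i)
      _ = P * G ^ k := (hk _ (le_max_left k i)).symm
  obtain ⟨k, hk⟩ := hl
  obtain ⟨k', hk'⟩ := hr
  refine ⟨ℓ * (k + 1 + k'), Nat.mul_pos hℓ (by omega), ?_⟩
  rw [eq_top_iff, pow_mul F, ← hG]
  calc (⊤ : Submodule ℂ (End ℂ V)) = ⊤ * P * ⊤ := (top_mul_span_singleton_mul_top hp0).symm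
    _ = ⊤ * P * (P * ⊤) := by rw [← mul_assoc, mul_assoc ⊤ P P, hPP]
    _ = G ^ k * P * (P * G ^ k') := by rw [hk, hk']
    _ = G ^ k * P * G ^ k' := by rw [← mul_assoc, mul_assoc _ P P, hPP]
    _ ≤ G ^ k * G * G ^ k' := mul_le_mul' (mul_le_mul' le_rfl hPG) le_rfl
    _ = G ^ (k + 1 + k') := by rw [pow_add G, pow_succ G]

omit [FiniteDimensional ℂ V] in
theorem pow_mul_eq_top {F : Submodule ℂ (End ℂ V)} {ℓ : ℕ} (hF : F ^ ℓ = ⊤) {m : ℕ} (hm : 1 ≤ m) :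
    F ^ (ℓ * m) = ⊤ := by
  rw [pow_mul F, hF]
  induction m, hm using Nat.le_induction with
  | base => exact pow_one _
  | succ m _ ih =>
    rw [pow_succ (⊤ : Submodule ℂ (End ℂ V)), ih, eq_top_iff]
    intro x _
    rw [← mul_one x]
    exact Submodule.mul_mem_mul Submodule.mem_top Submodule.mem_top

end SingleBlock

/-! ### Separating two representations -/

section Pair

variable {A : Type*} [Ring A] [Algebra ℂ A] {G : Submodule ℂ A}
  {U : Type*} [AddCommGroup U] [Module ℂ U] [FiniteDimensional ℂ U]
  {W : Type*} [AddCommGroup W] [Module ℂ W] [FiniteDimensional ℂ W]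

-- The products of `z` with one word of `G` on each side stay in the kernel of `σ`, while their
-- images under `ρ` span a nonzero two-sided ideal of a simple algebra. The two extra factors
-- account for the exponent `m + 2`.
omit [FiniteDimensional ℂ W] in
theorem exists_mem_pow_of_map_ne_zero (ρ : A →ₐ[ℂ] End ℂ U) (σ : A →ₐ[ℂ] End ℂ W)
    (hρ : G.map ρ.toLinearMap = ⊤) {m : ℕ} {z : A} (hz : z ∈ G ^ m) (hσz : σ z = 0)
    (hρz : ρ z ≠ 0) (y : End ℂ U) : ∃ z' ∈ G ^ (m + 2), ρ z' = y ∧ σ z' = 0 := by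
  set K : Submodule ℂ A := Submodule.span ℂ {z} with hK
  have hmap : (G * K * G).map ρ.toLinearMap = ⊤ := by
    rw [Submodule.map_mul, Submodule.map_mul, hρ, hK, Submodule.map_span, Set.image_singleton]
    exact top_mul_span_singleton_mul_top hρz
  have hle : G * K * G ≤ G ^ (m + 2) := by
    rw [pow_succ, pow_succ']
    exact mul_le_mul' (mul_le_mul' le_rfl ((Submodule.span_singleton_le_iff_mem _ _).2 hz)) le_rfl
  have hker : G * K * G ≤ LinearMap.ker σ.toLinearMap := by
    rw [Submodule.mul_le]
    intro x hx y _
    refine (?_ : σ (x * y) = 0)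
    have hx0 : σ x = 0 := by
      refine Submodule.mul_induction_on hx (fun a _ b hb => ?_) fun a b ha hb => ?_
      · obtain ⟨c, rfl⟩ := Submodule.mem_span_singleton.1 hb
        rw [map_mul, map_smul, hσz, smul_zero, mul_zero]
      · rw [map_add, ha, hb, add_zero]
    rw [map_mul, hx0, zero_mul]
  have hy : y ∈ (G * K * G).map ρ.toLinearMap := by rw [hmap]; trivial
  obtain ⟨z', hz', rfl⟩ := hy
  exact ⟨z', hle hz', rfl, hker hz'⟩

omit [FiniteDimensional ℂ W] in
theorem exists_eq_smul_one_of_forall_commute (u : End ℂ W) (h : ∀ w : End ℂ W, w * u = u * w) :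
    ∃ c : ℂ, u = c • (1 : End ℂ W) := by
  have hu : u ∈ Subalgebra.center ℂ (End ℂ W) :=
    Subalgebra.mem_center_iff.2 fun w => h w
  rw [Algebra.IsCentral.center_eq_bot] at hu
  obtain ⟨c, hc⟩ := Algebra.mem_bot.1 hu
  exact ⟨c, by rw [← hc, Algebra.algebraMap_eq_smul_one]⟩

/-- Two representations in which words of any length `m ≥ 1` span everything can be separated by
words of some fixed length, unless they are conjugate up to a scalar. -/
theorem exists_separating_or_conjugate [Nontrivial U] (ρ : A →ₐ[ℂ] End ℂ U) (σ : A →ₐ[ℂ] End ℂ W)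
    (hρ : ∀ m, 1 ≤ m → (G ^ m).map ρ.toLinearMap = ⊤)
    (hσ : ∀ m, 1 ≤ m → (G ^ m).map σ.toLinearMap = ⊤) :
    (∃ m, 1 ≤ m ∧ ∃ z ∈ G ^ m, ρ z = 1 ∧ σ z = 0) ∨
      ∃ c : ℂ, c ≠ 0 ∧ ∃ X : U ≃ₗ[ℂ] W, ∀ z ∈ G, ∀ u, σ z (X u) = c • X (ρ z u) := by
  have hρ1 : G.map ρ.toLinearMap = ⊤ := by simpa using hρ 1 le_rfl
  have hσ1 : G.map σ.toLinearMap = ⊤ := by simpa using hσ 1 le_rfl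
  rw [or_iff_not_imp_left]
  intro hsep
  have h1 : ∀ m, 1 ≤ m → ∀ z ∈ G ^ m, σ z = 0 → ρ z = 0 := by
    intro m _ z hz h0
    by_contra hne
    obtain ⟨z', hz', h⟩ := exists_mem_pow_of_map_ne_zero ρ σ hρ1 hz h0 hne 1
    exact hsep ⟨m + 2, by omega, z', hz', h⟩
  have h2 : ∀ m, 1 ≤ m → ∀ z ∈ G ^ m, ρ z = 0 → σ z = 0 := by
    intro m _ z hz h0
    by_contra hne
    have : (1 : End ℂ U) ∈ (G ^ (m + 2)).map ρ.toLinearMap := by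
      rw [hρ _ (by omega)]; trivial
    obtain ⟨z₁, hz₁, hz₁1⟩ := this
    -- Here the roles are exchanged: `z'` copies `z₁` under `σ` and vanishes under `ρ`, so `z₁ - z'`
    -- separates in the required direction.
    obtain ⟨z', hz', hy, h⟩ := exists_mem_pow_of_map_ne_zero σ ρ hσ1 hz h0 hne (σ z₁)
    refine hsep ⟨m + 2, by omega, z₁ - z', sub_mem hz₁ hz', ?_, ?_⟩
    · rw [map_sub, h, sub_zero]; exact hz₁1
    · rw [map_sub, hy, sub_self]
  have h3 : ∀ m, 1 ≤ m → ∀ z ∈ G ^ m, ∀ z' ∈ G ^ m, ρ z = ρ z' → σ z = σ z' := by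
    intro m hm z hz z' hz' h
    rw [← sub_eq_zero, ← map_sub]
    exact h2 m hm _ (sub_mem hz hz') (by rw [map_sub, h, sub_self])
  have hlift : ∀ y : End ℂ U, ∃ z ∈ G, ρ z = y := by
    intro y
    have : y ∈ G.map ρ.toLinearMap := by rw [hρ1]; trivial
    exact this
  choose s hsG hs using hlift
  have h3' : ∀ z ∈ G, ∀ y, ρ z = y → σ z = σ (s y) := by
    intro z hz y hy
    refine h3 1 le_rfl z (by simpa using hz) _ (by simpa using hsG y) ?_
    rw [hs, hy]
  have hG2 : ∀ {a b : A}, a ∈ G → b ∈ G → a * b ∈ G ^ 2 := fun ha hb => by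
    rw [pow_two]; exact Submodule.mul_mem_mul ha hb
  -- `G` need not contain the unit, so the lift of 1 under `ρ` acts through `σ` only as a scalar.
  -- Products have length two, and padding with this lift makes them comparable with elements of
  -- `G`; hence the factor `c` in `hmul`. Dividing it out gives an algebra isomorphism, which is
  -- inner.
  obtain ⟨c, hc⟩ := exists_eq_smul_one_of_forall_commute (σ (s 1)) fun w => by
    have : w ∈ G.map σ.toLinearMap := by rw [hσ1]; trivial
    obtain ⟨z, hz, rfl⟩ := this
    change σ z * _ = _ * σ z
    rw [← map_mul, ← map_mul]
    refine h3 2 (by omega) _ (hG2 hz (hsG 1)) _ (hG2 (hsG 1) hz) ?_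
    rw [map_mul, map_mul, hs, mul_one, one_mul]
  have hc0 : c ≠ 0 := by
    rintro rfl
    rw [zero_smul] at hc
    have := h1 1 le_rfl (s 1) (by simpa using hsG 1) hc
    rw [hs] at this
    exact one_ne_zero this
  have hmul : ∀ y y', σ (s y) * σ (s y') = c • σ (s (y * y')) := by
    intro y y'
    have := h3 2 (by omega) _ (hG2 (hsG y) (hsG y')) _ (hG2 (hsG (y * y')) (hsG 1))
      (by rw [map_mul, map_mul, hs, hs, hs, hs, mul_one])
    rw [map_mul, map_mul, hc, mul_smul_comm, mul_one] at this
    exact this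
  let θ : End ℂ U →ₗ[ℂ] End ℂ W :=
    { toFun := fun y => σ (s y)
      map_add' := fun y y' => by
        rw [← map_add]
        exact (h3' _ (add_mem (hsG y) (hsG y')) _ (by rw [map_add, hs, hs])).symm
      map_smul' := fun a y => by
        rw [RingHom.id_apply, ← map_smul]
        exact (h3' _ (Submodule.smul_mem _ a (hsG y)) _ (by rw [map_smul, hs])).symm }
  let ψ : End ℂ U →ₐ[ℂ] End ℂ W := AlgHom.ofLinearMap (c⁻¹ • θ)
    (by
      change c⁻¹ • σ (s 1) = 1
      rw [hc, smul_smul, inv_mul_cancel₀ hc0, one_smul])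
    (fun y y' => by
      change c⁻¹ • σ (s (y * y')) = (c⁻¹ • σ (s y)) * (c⁻¹ • σ (s y'))
      rw [smul_mul_smul_comm, hmul, smul_smul, mul_assoc, inv_mul_cancel₀ hc0, mul_one])
  have hψ : ∀ y, ψ y = c⁻¹ • σ (s y) := fun _ => rfl
  have hbij : Function.Bijective ψ := by
    constructor
    · rw [injective_iff_map_eq_zero]
      intro y hy
      rw [hψ, smul_eq_zero] at hy
      have := h1 1 le_rfl (s y) (by simpa using hsG y) (hy.resolve_left (inv_ne_zero hc0))
      rwa [hs] at this
    · intro w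
      have : c • w ∈ G.map σ.toLinearMap := by rw [hσ1]; trivial
      obtain ⟨z, hz, hzw⟩ := this
      refine ⟨ρ z, ?_⟩
      have hzw' : σ z = c • w := hzw
      rw [hψ, ← h3' z hz _ rfl, hzw', smul_smul, inv_mul_cancel₀ hc0, one_smul]
  obtain ⟨X, hX⟩ := (AlgEquiv.ofBijective ψ hbij).eq_linearEquivConjAlgEquiv
  refine ⟨c, hc0, X, fun z hz u => ?_⟩
  have h4 : σ z = c • ψ (ρ z) := by
    rw [hψ, smul_smul, mul_inv_cancel₀ hc0, one_smul]
    exact h3' z hz _ rfl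
  have h5 : ψ (ρ z) (X u) = X (ρ z u) := by
    have : ψ (ρ z) = X.conjAlgEquiv ℂ (ρ z) := by rw [← hX]; rfl
    rw [this, LinearEquiv.conjAlgEquiv_apply]
    simp
  rw [h4, LinearMap.smul_apply, h5]

end Pair

/-! ### Joint fullness of finitely many representations -/

section BlockInjectivity

variable {A : Type*} [Ring A] [Algebra ℂ A]

theorem map_apply_of_mem_pow {U W : Type*} [AddCommGroup U] [Module ℂ U] [AddCommGroup W]
    [Module ℂ W] (ρ : A →ₐ[ℂ] End ℂ U) (σ : A →ₐ[ℂ] End ℂ W) {G : Submodule ℂ A} {c : ℂ}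
    {X : U ≃ₗ[ℂ] W} (h : ∀ z ∈ G, ∀ u, σ z (X u) = c • X (ρ z u)) (k : ℕ) :
    ∀ z ∈ G ^ k, ∀ u, σ z (X u) = c ^ k • X (ρ z u) := by
  induction k with
  | zero =>
    intro z hz u
    rw [pow_zero] at hz
    obtain ⟨a, rfl⟩ := Submodule.mem_one.1 hz
    simp
  | succ k ih =>
    intro z hz
    rw [pow_succ] at hz
    refine Submodule.mul_induction_on hz (fun a ha b hb u => ?_) fun a b ha hb u => ?_
    · rw [map_mul, map_mul, Module.End.mul_apply, Module.End.mul_apply, h b hb, map_smul, ih a ha,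
        smul_smul, pow_succ']
    · rw [map_add, map_add, LinearMap.add_apply, LinearMap.add_apply, ha, hb, map_add, smul_add]

/-- The separators are multiplied, one factor for each element of `T`. If `j` itself is in `T`, any
lift of 1 fills its place, so the length depends only on the cardinality. -/
theorem exists_mem_pow_separating {ι : Type*} [DecidableEq ι] {W : ι → Type*}
    [∀ a, AddCommGroup (W a)] [∀ a, Module ℂ (W a)] (ρ : ∀ a, A →ₐ[ℂ] End ℂ (W a))
    {K : Submodule ℂ A} (j : ι) (hone : ∃ z ∈ K, ρ j z = 1)
    (hsep : ∀ j', j' ≠ j → ∃ z ∈ K, ρ j z = 1 ∧ ρ j' z = 0) (T : Finset ι) :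
    ∃ x ∈ K ^ T.card, ρ j x = 1 ∧ ∀ j' ∈ T, j' ≠ j → ρ j' x = 0 := by
  induction T using Finset.induction_on with
  | empty => exact ⟨1, by simp [Submodule.one_le.1 le_rfl], map_one _, by simp⟩
  | insert a T ha ih =>
    obtain ⟨x, hx, hx1, hx0⟩ := ih
    obtain ⟨z, hz, hz1, hz0⟩ : ∃ z ∈ K, ρ j z = 1 ∧ (a ≠ j → ρ a z = 0) := by
      by_cases haj : a = j
      · obtain ⟨z, hz, h1⟩ := hone
        exact ⟨z, hz, h1, fun h => absurd haj h⟩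
      · obtain ⟨z, hz, h1, h0⟩ := hsep a haj
        exact ⟨z, hz, h1, fun _ => h0⟩
    refine ⟨x * z, ?_, by rw [map_mul, hx1, hz1, mul_one], fun j' hj' hne => ?_⟩
    · rw [Finset.card_insert_of_notMem ha, pow_succ]
      exact Submodule.mul_mem_mul hx hz
    · rcases Finset.mem_insert.1 hj' with rfl | hj'
      · rw [map_mul, hz0 hne, mul_zero]
      · rw [map_mul, hx0 j' hj' hne, zero_mul]

/-- Pairwise separated full representations are jointly full on words of some fixed length. -/
theorem exists_joint_lift {ι : Type*} [Fintype ι] [DecidableEq ι] {W : ι → Type*}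
    [∀ a, AddCommGroup (W a)] [∀ a, Module ℂ (W a)] (ρ : ∀ a, A →ₐ[ℂ] End ℂ (W a))
    {K : Submodule ℂ A} (hfull : ∀ j, ∀ y, ∃ z ∈ K, ρ j z = y)
    (hsep : ∀ j j', j' ≠ j → ∃ z ∈ K, ρ j z = 1 ∧ ρ j' z = 0) {m : ℕ} (hm : 1 ≤ m)
    (y : ∀ j, End ℂ (W j)) : ∃ x ∈ K ^ ((Fintype.card ι + 1) * m), ∀ j, ρ j x = y j := by
  have h1 : ∀ y : ∀ j, End ℂ (W j), ∃ x ∈ K ^ (Fintype.card ι + 1), ∀ j, ρ j x = y j := by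
    intro y
    have : ∀ j, ∃ x ∈ K ^ (Fintype.card ι + 1), ρ j x = y j ∧ ∀ j', j' ≠ j → ρ j' x = 0 := by
      intro j
      obtain ⟨x, hx, hx1, hx0⟩ := exists_mem_pow_separating ρ j (hfull j 1) (hsep j) Finset.univ
      obtain ⟨z, hz, hzy⟩ := hfull j (y j)
      refine ⟨x * z, ?_, by rw [map_mul, hx1, hzy, one_mul], fun j' hne => ?_⟩
      · rw [pow_succ]
        exact Submodule.mul_mem_mul hx hz
      · rw [map_mul, hx0 j' (Finset.mem_univ _) hne, zero_mul]
    choose x hx hxy hx0 using this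
    refine ⟨∑ j, x j, sum_mem fun j _ => hx j, fun j => ?_⟩
    rw [map_sum, Finset.sum_eq_single j, hxy]
    · exact fun i _ hi => hx0 i j hi.symm
    · exact fun h => absurd (Finset.mem_univ j) h
  obtain ⟨k, rfl⟩ : ∃ k, m = k + 1 := ⟨m - 1, by omega⟩
  obtain ⟨x, hx, hxy⟩ := h1 y
  -- Powers of a joint lift of the identity pad the words to any multiple of the length.
  obtain ⟨e, he, he1⟩ := h1 fun _ => 1
  refine ⟨x * e ^ k, ?_, fun j => by rw [map_mul, map_pow, hxy, he1, one_pow, mul_one]⟩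
  rw [pow_mul, pow_succ']
  exact Submodule.mul_mem_mul hx (Submodule.pow_mem_pow _ he k)

/-- After sufficient blocking, finitely many totally irreducible representations are either zero
or fall into classes of representations conjugate up to scalars, and representatives of the
classes are jointly full. -/
theorem exists_block_injective_classes {ι : Type*} [Fintype ι] {W : ι → Type*}
    [∀ a, AddCommGroup (W a)] [∀ a, Module ℂ (W a)] [∀ a, FiniteDimensional ℂ (W a)]
    [∀ a, Nontrivial (W a)] (ρ : ∀ a, A →ₐ[ℂ] End ℂ (W a)) (F : Submodule ℂ A)
    (hF : ∀ a m, 1 ≤ m → Algebra.adjoin ℂ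
      (((F.map (ρ a).toLinearMap) ^ m : Submodule ℂ (End ℂ (W a))) : Set (End ℂ (W a))) = ⊤) :
    ∃ L, 1 ≤ L ∧ ∃ (q : ℕ) (c : ι → Option (Fin q)) (r : Fin q → ι), (∀ j, c (r j) = some j) ∧
      (∀ a, c a = none → ∀ m, 1 ≤ m → ∀ x ∈ F ^ (L * m), ρ a x = 0) ∧
      (∀ a j, c a = some j → ∃ μ : ℂ, μ ≠ 0 ∧ ∃ X : W a ≃ₗ[ℂ] W (r j), ∀ m, 1 ≤ m →
        ∀ x ∈ F ^ (L * m), ∀ u, ρ (r j) x (X u) = μ ^ m • X (ρ a x u)) ∧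
      (∀ m, 1 ≤ m → ∀ y : ∀ j, End ℂ (W (r j)), ∃ x ∈ F ^ (L * m), ∀ j, ρ (r j) x = y j) := by
  classical
  let nz : ι → Prop := fun a => F.map (ρ a).toLinearMap ≠ ⊥
  have hzero : ∀ a, ¬ nz a → ∀ m, 1 ≤ m → ∀ x ∈ F ^ m, ρ a x = 0 := by
    intro a ha m hm x hx
    have h0 : F.map (ρ a).toLinearMap = ⊥ := not_not.1 ha
    have : ρ a x ∈ (F ^ m).map (ρ a).toLinearMap := ⟨x, hx, rfl⟩
    rw [Submodule.map_pow, h0, Submodule.bot_pow (by omega)] at this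
    exact (Submodule.mem_bot ℂ).1 this
  have hfull : ∀ a, ∃ ℓ, 1 ≤ ℓ ∧ (nz a → (F.map (ρ a).toLinearMap) ^ ℓ = ⊤) := by
    intro a
    by_cases ha : nz a
    · obtain ⟨ℓ, hℓ, h⟩ := exists_pow_eq_top (hF a) ha
      exact ⟨ℓ, hℓ, fun _ => h⟩
    · exact ⟨1, le_rfl, fun h => absurd h ha⟩
  choose ℓ hℓ hℓtop using hfull
  -- A product of the individual lengths is a common multiple, at which all nonzero representations
  -- are full simultaneously.
  set L₁ := ∏ a, ℓ a with hL₁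
  have hL₁pos : 1 ≤ L₁ := by
    rw [hL₁]; exact Finset.prod_pos (f := ℓ) fun a _ => hℓ a
  set G := F ^ L₁ with hG
  have hGtop : ∀ a, nz a → ∀ m, 1 ≤ m → (G ^ m).map (ρ a).toLinearMap = ⊤ := by
    intro a ha m hm
    obtain ⟨k, hk⟩ := Finset.dvd_prod_of_mem ℓ (Finset.mem_univ a)
    have hk0 : 1 ≤ k := by
      rcases Nat.eq_zero_or_pos k with rfl | h
      · rw [mul_zero] at hk; omega
      · exact h
    rw [hG, ← pow_mul, hL₁, hk, mul_assoc, Submodule.map_pow]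
    exact pow_mul_eq_top (hℓtop a ha) (Nat.mul_pos hk0 hm)
  let st : Setoid {a // nz a} :=
    { r := fun a b => ∃ c : ℂ, c ≠ 0 ∧ ∃ X : W a ≃ₗ[ℂ] W b, ∀ z ∈ G, ∀ u,
        ρ b z (X u) = c • X (ρ a z u)
      iseqv :=
        { refl := fun a => ⟨1, one_ne_zero, LinearEquiv.refl ℂ _, fun z _ u => by simp⟩
          symm := by
            rintro a b ⟨c, hc, X, h⟩
            refine ⟨c⁻¹, inv_ne_zero hc, X.symm, fun z hz u => ?_⟩
            have h1 := h z hz (X.symm u)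
            rw [LinearEquiv.apply_symm_apply] at h1
            rw [h1, map_smul, LinearEquiv.symm_apply_apply, smul_smul, inv_mul_cancel₀ hc, one_smul]
          trans := by
            rintro a b d ⟨c, hc, X, h⟩ ⟨c', hc', X', h'⟩
            refine ⟨c * c', mul_ne_zero hc hc', X.trans X', fun z hz u => ?_⟩
            rw [LinearEquiv.trans_apply, h' z hz, h z hz, map_smul, smul_smul, mul_comm c',
              LinearEquiv.trans_apply] } }
  let φ : Quotient st ≃ Fin (Fintype.card (Quotient st)) := Fintype.equivFin _
  set q := Fintype.card (Quotient st) with hq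
  let r : Fin q → ι := fun j => ((φ.symm j).out : {a // nz a})
  have hrnz : ∀ j, nz (r j) := fun j => (φ.symm j).out.2
  let c : ι → Option (Fin q) := fun a => if h : nz a then some (φ ⟦⟨a, h⟩⟧) else none
  have hsep : ∀ j j', ∃ ℓ, 1 ≤ ℓ ∧ (j' ≠ j → ∃ z ∈ G ^ ℓ, ρ (r j) z = 1 ∧ ρ (r j') z = 0) := by
    intro j j'
    by_cases hjj : j' = j
    · exact ⟨1, le_rfl, fun h => absurd hjj h⟩
    rcases exists_separating_or_conjugate (ρ (r j)) (ρ (r j')) (hGtop _ (hrnz j))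
      (hGtop _ (hrnz j')) with ⟨m, hm, h⟩ | h
    · exact ⟨m, hm, fun _ => h⟩
    · refine absurd ?_ hjj
      have hr : (φ.symm j).out ≈ (φ.symm j').out := h
      have := Quotient.sound hr
      rw [Quotient.out_eq, Quotient.out_eq] at this
      exact (φ.symm.injective this).symm
  choose k hk hksep using hsep
  set L₂ := ∏ p : Fin q × Fin q, k p.1 p.2 with hL₂
  have hL₂pos : 1 ≤ L₂ := by
    rw [hL₂]; exact Finset.prod_pos (f := fun p : Fin q × Fin q => k p.1 p.2) fun p _ => hk p.1 p.2
  set K := G ^ L₂ with hK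
  have hKfull : ∀ j, ∀ y, ∃ z ∈ K, ρ (r j) z = y := by
    intro j y
    have : y ∈ K.map (ρ (r j)).toLinearMap := by rw [hGtop _ (hrnz j) _ hL₂pos]; trivial
    exact this
  have hKsep : ∀ j j', j' ≠ j → ∃ z ∈ K, ρ (r j) z = 1 ∧ ρ (r j') z = 0 := by
    intro j j' hne
    obtain ⟨z, hz, h1, h0⟩ := hksep j j' hne
    obtain ⟨t, ht⟩ := Finset.dvd_prod_of_mem (fun p : Fin q × Fin q => k p.1 p.2)
      (Finset.mem_univ (j, j'))
    have ht0 : t ≠ 0 := by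
      rintro rfl
      rw [mul_zero] at ht; omega
    refine ⟨z ^ t, ?_, by rw [map_pow, h1, one_pow], by rw [map_pow, h0, zero_pow ht0]⟩
    rw [hK, hL₂, ht, pow_mul]
    exact Submodule.pow_mem_pow _ hz t
  have hLpow : ∀ m, F ^ (L₁ * (L₂ * (q + 1)) * m) = K ^ ((q + 1) * m) := by
    intro m
    rw [hK, hG, ← pow_mul, ← pow_mul]
    congr 1
    ring
  refine ⟨L₁ * (L₂ * (q + 1)), Nat.mul_pos hL₁pos (Nat.mul_pos hL₂pos (Nat.succ_pos q)), q, c, r,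
    ?_, ?_, ?_, ?_⟩
  · intro j
    have : (⟦⟨r j, hrnz j⟩⟧ : Quotient st) = φ.symm j := Quotient.out_eq (φ.symm j)
    simp only [c, hrnz j, dif_pos, this, Equiv.apply_symm_apply]
  · intro a ha m hm x hx
    have hna : ¬ nz a := by
      intro h
      rw [show c a = some _ from dif_pos h] at ha
      exact absurd ha (Option.some_ne_none _)
    exact hzero a hna _ (Nat.mul_pos (Nat.mul_pos hL₁pos (Nat.mul_pos hL₂pos (Nat.succ_pos q))) hm)
      x hx
  · intro a j ha
    have hna : nz a := by
      refine not_not.1 fun h => ?_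
      rw [show c a = none from dif_neg h] at ha
      exact Option.some_ne_none j ha.symm
    have hφ : φ ⟦⟨a, hna⟩⟧ = j := by simpa [c, hna] using ha
    have hrel : st.r ⟨a, hna⟩ (φ.symm j).out := by
      refine Quotient.exact ?_
      rw [Quotient.out_eq, ← hφ, Equiv.symm_apply_apply]
    obtain ⟨b, hb, X, hX⟩ := hrel
    -- A word of length `L` consists of `L₂ * (q + 1)` factors from `G`, each contributing one
    -- scalar `b`.
    refine ⟨b ^ (L₂ * (q + 1)), pow_ne_zero _ hb, X, fun m hm x hx u => ?_⟩
    rw [mul_assoc, pow_mul] at hx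
    rw [← pow_mul]
    exact map_apply_of_mem_pow (ρ a) (ρ (r j)) hX _ x hx u
  · intro m hm y
    obtain ⟨x, hx, h⟩ := exists_joint_lift (fun j => ρ (r j)) hKfull hKsep hm y
    rw [Fintype.card_fin] at hx
    exact ⟨x, by rw [hLpow]; exact hx, h⟩

end BlockInjectivity

/-! ### Bases of the totally irreducible pieces -/

section AdaptedBasis

/-- The vectors supported on the basis elements with a given label. -/
def labelSubspace {n κ : Type*} (label : n → κ) (k : κ) : Submodule ℂ (n → ℂ) where
  carrier := {v | ∀ x, label x ≠ k → v x = 0}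
  add_mem' hv hw x hx := by rw [Pi.add_apply, hv x hx, hw x hx, add_zero]
  zero_mem' _ _ := rfl
  smul_mem' c v hv x hx := by rw [Pi.smul_apply, hv x hx, smul_zero]

open Classical in
/-- Extension by zero identifies the vectors on the fibre of a label with `labelSubspace`. -/
noncomputable def labelEquiv {n κ : Type*} (label : n → κ) (k : κ) :
    labelSubspace label k ≃ₗ[ℂ] ({x // label x = k} → ℂ) where
  toFun v x := v.1 x
  map_add' _ _ := rfl
  map_smul' _ _ := rfl
  invFun w := ⟨fun x => if h : label x = k then w ⟨x, h⟩ else 0, fun _ hx => dif_neg hx⟩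
  left_inv v := by
    ext x
    by_cases h : label x = k
    · simp [h]
    · simp [h, v.2 x h]
  right_inv w := by
    ext x
    simp [x.2]

theorem finrank_labelSubspace {n κ : Type*} [Fintype n] [DecidableEq κ] (label : n → κ) (k : κ) :
    finrank ℂ (labelSubspace label k) = Fintype.card {x // label x = k} := by
  rw [(labelEquiv label k).finrank_eq, finrank_fintype_fun_eq_card]

theorem iSup_labelSubspace {n κ : Type*} [Fintype n] (label : n → κ) :
    ⨆ k, labelSubspace label k = ⊤ := by
  classical
  rw [eq_top_iff]
  intro v _
  rw [← Finset.univ_sum_single v]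
  refine sum_mem fun x _ => Submodule.mem_iSup_of_mem (label x) fun y hy => ?_
  exact Pi.single_eq_of_ne (fun h => hy (congrArg label h)) _

variable {V : Type*} [AddCommGroup V] [Module ℂ V] [FiniteDimensional ℂ V]

-- If all operators vanish on `U`, every line in it is invariant. This forces size 1 for the blocks
-- of class `none`.
omit [FiniteDimensional ℂ V] in
theorem finrank_eq_one_of_forall_eq_zero {S : Submodule ℂ (End ℂ V)} {U : Submodule ℂ V}
    (hU : IsIrreducibleOn S U) (h : ∀ x ∈ S, ∀ v ∈ U, x v = 0) : finrank ℂ U = 1 := by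
  obtain ⟨v, hv, hv0⟩ := Submodule.exists_mem_ne_zero_of_ne_bot hU.ne_bot
  have hle : Submodule.span ℂ {v} ≤ U := (Submodule.span_singleton_le_iff_mem v U).2 hv
  rcases hU.eq_bot_or_eq _ hle fun x hx w hw => by
    rw [h x hx w (hle hw)]; exact zero_mem _ with h0 | h0
  · exact absurd (Submodule.span_singleton_eq_bot.1 h0) hv0
  · rw [← h0]
    exact finrank_span_singleton hv0

/-- Block-injective classes for an invariant family of subspaces, in terms of bases. -/
theorem exists_bases_of_totallyIrreducible {S : Submodule ℂ (End ℂ V)} {α : Type*} [Fintype α]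
    (W : α → Submodule ℂ V) (hW : ∀ a, IsTotallyIrreducibleOn S (W a)) :
    ∃ L, 1 ≤ L ∧ ∃ (q : ℕ) (dim : Fin q → ℕ) (c : α → Option (Fin q)) (μ : α → ℂ)
      (b : ∀ a, Basis (Fin (blockDim dim (c a))) ℂ (W a))
      (M : End ℂ V →ₗ[ℂ] ∀ o : Option (Fin q),
        Matrix (Fin (blockDim dim o)) (Fin (blockDim dim o)) ℂ),
      (∀ j, 0 < dim j) ∧ (∀ a, μ a ≠ 0) ∧ (∀ j, ∃ a, c a = some j ∧ μ a = 1) ∧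
      (∀ x, M x none = 0) ∧
      (∀ m, 1 ≤ m → ∀ x ∈ S ^ (L * m), ∀ a i,
        x (b a i) = ∑ i', (μ a ^ m * M x (c a) i' i) • (b a i' : V)) ∧
      (∀ m, 1 ≤ m → ∀ N : ∀ o : Option (Fin q),
        Matrix (Fin (blockDim dim o)) (Fin (blockDim dim o)) ℂ, N none = 0 →
        ∃ x ∈ S ^ (L * m), M x = N) := by
  classical
  have hinv : ∀ a, ∀ x ∈ S, x ∈ stabilizer (W a) := fun a x hx =>
    (hW a 1 le_rfl).invariant x (by rwa [pow_one])
  let A : Subalgebra ℂ (End ℂ V) := ⨅ a, stabilizer (W a)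
  have hA : ∀ a, A ≤ stabilizer (W a) := fun a => iInf_le _ a
  let ρ : ∀ a, A →ₐ[ℂ] End ℂ (W a) := fun a =>
    (restrictHom (W a)).comp (Subalgebra.inclusion (hA a))
  have hρ : ∀ a (x : A) (v : W a), (ρ a x v : V) = x.1 v := fun _ _ _ => rfl
  have hSA : S ≤ Subalgebra.toSubmodule A := fun x hx => by
    rw [Subalgebra.mem_toSubmodule, Algebra.mem_iInf]
    exact fun a => hinv a x hx
  let F : Submodule ℂ A := S.comap A.val.toLinearMap
  have hFmap : ∀ k x, x ∈ S ^ k → ∃ y ∈ F ^ k, (y : End ℂ V) = x := fun k x hx => by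
    rw [← map_val_comap_pow hSA k] at hx
    exact hx
  have hFmem : ∀ k, ∀ y ∈ F ^ k, (y : End ℂ V) ∈ S ^ k := fun k y hy => by
    rw [← map_val_comap_pow hSA k]
    exact ⟨y, hy, rfl⟩
  have hnt : ∀ a, Nontrivial (W a) := fun a =>
    Submodule.nontrivial_iff_ne_bot.2 (hW a 1 le_rfl).ne_bot
  obtain ⟨L, hL, q, c, r, hcr, hnone, hsome, hlift⟩ :=
    exists_block_injective_classes ρ F fun a m hm => by
      rw [eq_top_iff, ← (hW a m hm).adjoin_eq_top]
      refine Algebra.adjoin_mono ?_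
      rintro _ ⟨⟨x, hx'⟩, hx, rfl⟩
      obtain ⟨y, hy, rfl⟩ := hFmap m x hx
      rw [← Submodule.map_pow]
      exact ⟨y, hy, rfl⟩
  let dim : Fin q → ℕ := fun j => finrank ℂ (W (r j))
  let β : ∀ j, Basis (Fin (blockDim dim (some j))) ℂ (W (r j)) := fun j => finBasis ℂ (W (r j))
  -- The projections only serve to extend the block matrices linearly to all of `End ℂ V`; on
  -- operators preserving the pieces the result is the matrix of the restriction.
  have hproj : ∀ j, ∃ π : V →ₗ[ℂ] W (r j), π ∘ₗ (W (r j)).subtype = LinearMap.id := fun j =>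
    LinearMap.exists_leftInverse_of_injective _ (W (r j)).ker_subtype
  choose π hπ using hproj
  let Mo : ∀ o : Option (Fin q), End ℂ V →ₗ[ℂ]
      Matrix (Fin (blockDim dim o)) (Fin (blockDim dim o)) ℂ := fun o =>
    match o with
    | none => 0
    | some j => (LinearMap.toMatrix (β j) (β j)).toLinearMap ∘ₗ
        LinearMap.llcomp ℂ _ _ _ (π j) ∘ₗ LinearMap.lcomp ℂ V (W (r j)).subtype
  have hMo : ∀ j (x : A), Mo (some j) x = LinearMap.toMatrix (β j) (β j) (ρ (r j) x) := by
    intro j x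
    refine congrArg (LinearMap.toMatrix (β j) (β j)) (LinearMap.ext fun v => ?_)
    exact LinearMap.congr_fun (hπ j) (ρ (r j) x v)
  -- An element acting as the identity on every representative forces the scalar relating a
  -- representative to itself to be 1.
  have hone : ∃ x ∈ F ^ (L * 1), ∀ j, ρ (r j) x = 1 := hlift 1 le_rfl fun _ => 1
  have hbasis : ∀ a o, c a = o → ∃ μ : ℂ, μ ≠ 0 ∧ (∀ j, a = r j → μ = 1) ∧
      ∃ b : Basis (Fin (blockDim dim o)) ℂ (W a), ∀ m, 1 ≤ m → ∀ x ∈ S ^ (L * m), ∀ i,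
        x (b i) = ∑ i', (μ ^ m * Mo o x i' i) • (b i' : V) := by
    intro a o hao
    cases o with
    | none =>
      refine ⟨1, one_ne_zero, fun _ _ => rfl, ?_⟩
      have hfin : finrank ℂ (W a) = blockDim dim none := by
        refine finrank_eq_one_of_forall_eq_zero (hW a (L * 1) (by omega)) fun x hx v hv => ?_
        obtain ⟨y, hy, rfl⟩ := hFmap _ x hx
        exact congrArg Subtype.val (LinearMap.congr_fun (hnone a hao 1 le_rfl y hy) ⟨v, hv⟩)
      refine ⟨finBasisOfFinrankEq ℂ (W a) hfin, fun m hm x hx i => ?_⟩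
      obtain ⟨y, hy, rfl⟩ := hFmap _ x hx
      have h0 := congrArg Subtype.val (LinearMap.congr_fun (hnone a hao m hm y hy)
        (finBasisOfFinrankEq ℂ (W a) hfin i))
      refine Eq.trans h0 ?_
      simp [Mo]
    | some j =>
      obtain ⟨ν, hν, X, hX⟩ := hsome a j hao
      refine ⟨ν⁻¹, inv_ne_zero hν, ?_, (β j).map X.symm, fun m hm x hx i => ?_⟩
      · rintro j' rfl
        obtain ⟨x, hx, hx1⟩ := hone
        obtain ⟨u, hu⟩ := exists_ne (0 : W (r j'))
        have := hX 1 le_rfl x hx u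
        rw [hx1, hx1, pow_one, Module.End.one_apply, Module.End.one_apply] at this
        have hXu : X u ≠ 0 := fun h => hu (X.map_eq_zero_iff.1 h)
        have h1 : (1 - ν) • X u = 0 := by rw [sub_smul, one_smul, ← this, sub_self]
        rw [← sub_eq_zero.1 ((smul_eq_zero.1 h1).resolve_right hXu), inv_one]
      · obtain ⟨y, hy, rfl⟩ := hFmap _ x hx
        have h1 := hX m hm y hy (X.symm (β j i))
        rw [LinearEquiv.apply_symm_apply] at h1
        have h2 : ρ a y (X.symm (β j i)) = (ν⁻¹ ^ m) • X.symm (ρ (r j) y (β j i)) := by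
          rw [h1, map_smul, LinearEquiv.symm_apply_apply, smul_smul, ← mul_pow,
            inv_mul_cancel₀ hν, one_pow, one_smul]
        have h3 : ρ (r j) y (β j i) = ∑ i', (Mo (some j) y i' i) • β j i' := by
          rw [hMo]
          exact ((β j).sum_repr _).symm.trans
            (Finset.sum_congr rfl fun i' _ => by rw [LinearMap.toMatrix_apply])
        rw [h3, map_sum, Finset.smul_sum] at h2
        have h4 := congrArg (Submodule.subtype (W a)) h2
        rw [map_sum] at h4
        refine (Eq.trans ?_ h4).trans (Finset.sum_congr rfl fun i' _ => ?_)
        · rw [Basis.map_apply]; rfl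
        · rw [map_smul X.symm, smul_smul, map_smul, Basis.map_apply]; rfl
  choose μ hμ hμ1 b hb using fun a => hbasis a (c a) rfl
  refine ⟨L, hL, q, dim, c, μ, b, LinearMap.pi Mo, fun j => finrank_pos, hμ,
    fun j => ⟨r j, hcr j, hμ1 (r j) j rfl⟩, fun x => rfl, fun m hm x hx a i => hb a m hm x hx i,
    fun m hm N hN => ?_⟩
  obtain ⟨x, hx, hxN⟩ := hlift m hm fun j => Matrix.toLin (β j) (β j) (N (some j))
  refine ⟨x, hFmem _ x hx, funext fun o => ?_⟩
  cases o with
  | none => rw [hN]; rfl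
  | some j =>
    rw [LinearMap.pi_apply, hMo, hxN, LinearMap.toMatrix_toLin]

end AdaptedBasis

/-! ### A basis compatible with the given ordered blocks -/

section AdaptedBasisMatrix

variable {n κ : Type*} [Fintype n] [LinearOrder κ]

/-- Every finite type over a linear order can be enumerated monotonically. -/
theorem exists_monotone_enumeration {α : Type*} [Fintype α] (g : α → κ) :
    ∃ ε : Fin (Fintype.card α) ≃ α, Monotone (g ∘ ε) :=
  ⟨(Tuple.sort (g ∘ (Fintype.equivFin α).symm)).trans (Fintype.equivFin α).symm,
    Tuple.monotone_sort (g ∘ (Fintype.equivFin α).symm)⟩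

/-- A basis adapted to the label decomposition in which, after blocking, the tensor is block
diagonal with jointly injective free blocks. -/
theorem exists_adapted_basis {S : Submodule ℂ (End ℂ (n → ℂ))} (label : n → κ)
    (hU : ∀ k, IsIrreducibleOn S (labelSubspace label k)) :
    ∃ L, 1 ≤ L ∧ ∃ (s q : ℕ) (dim : Fin q → ℕ) (cls : Fin s → Option (Fin q))
      (e : n ≃ Σ k : Fin s, Fin (blockDim dim (cls k))) (f : Fin s → κ) (μ : Fin s → ℂ)
      (B : Basis n ℂ (n → ℂ))
      (M : End ℂ (n → ℂ) →ₗ[ℂ] ∀ o : Option (Fin q),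
        Matrix (Fin (blockDim dim o)) (Fin (blockDim dim o)) ℂ),
      (∀ j, 0 < dim j) ∧ Monotone f ∧ (∀ x, label x = f (e x).1) ∧
      (∀ x, B x ∈ labelSubspace label (label x)) ∧
      (∀ k, μ k ≠ 0) ∧ (∀ j, ∃ k, cls k = some j ∧ μ k = 1) ∧ (∀ x, M x none = 0) ∧
      (∀ m, 1 ≤ m → ∀ x ∈ S ^ (L * m), ∀ y, x (B y) = ∑ i',
        (μ (e y).1 ^ m * M x (cls (e y).1) i' (e y).2) • B (e.symm ⟨(e y).1, i'⟩)) ∧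
      (∀ m, 1 ≤ m → ∀ N : ∀ o : Option (Fin q),
        Matrix (Fin (blockDim dim o)) (Fin (blockDim dim o)) ℂ, N none = 0 →
        ∃ x ∈ S ^ (L * m), M x = N) := by
  classical
  have hsurj : Function.Surjective label := by
    intro k
    obtain ⟨v, hv, hv0⟩ := Submodule.exists_mem_ne_zero_of_ne_bot (hU k).ne_bot
    by_contra hk
    push Not at hk
    exact hv0 (funext fun x => hv x (hk x))
  have : Finite κ := Finite.of_surjective label hsurj
  have : Fintype κ := Fintype.ofFinite κ
  have hcompl : ∀ ℓ, 1 ≤ ℓ → ∀ W : Submodule ℂ (n → ℂ), (∀ x ∈ S ^ ℓ, x ∈ stabilizer W) →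
      ∃ W' : Submodule ℂ (n → ℂ), (∀ x ∈ S ^ ℓ, x ∈ stabilizer W') ∧ IsCompl W W' :=
    fun ℓ hℓ W hW => exists_isCompl_invariant hU (iSup_labelSubspace label) hℓ W hW
  have hdec := fun k => exists_totallyIrreducible_decomposition hcompl _ (labelSubspace label k) 1
    le_rfl (by simpa using (hU k).invariant) le_rfl
  choose t ht N W hWsup hWdim hWirr using hdec
  set T := ∏ k, t k with hT
  have hTpos : 1 ≤ T := by rw [hT]; exact Finset.prod_pos (f := t) fun k _ => ht k
  let α := Σ k, Fin (N k)
  let Wα : α → Submodule ℂ (n → ℂ) := fun a => W a.1 a.2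
  have hirr : ∀ a, IsTotallyIrreducibleOn (S ^ T) (Wα a) := by
    rintro ⟨k, i⟩
    obtain ⟨u, hu⟩ := Finset.dvd_prod_of_mem t (Finset.mem_univ k)
    have hu0 : 1 ≤ u := by
      rcases Nat.eq_zero_or_pos u with rfl | h
      · rw [mul_zero] at hu; omega
      · exact h
    rw [hT, hu, pow_mul S]
    have := (hWirr k i).pow hu0
    rwa [one_mul] at this
  obtain ⟨L, hL, q, dim, c, μ, b, M, hdim, hμ, hreal, hMnone, hact, hlift⟩ :=
    exists_bases_of_totallyIrreducible Wα hirr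
  obtain ⟨ε, hε⟩ := exists_monotone_enumeration (fun a : α => a.1)
  let J := Σ k : Fin (Fintype.card α), Fin (blockDim dim (c (ε k)))
  have hblock : ∀ a, blockDim dim (c a) = finrank ℂ (Wα a) := fun a => by
    rw [finrank_eq_card_basis (b a), Fintype.card_fin]
  -- Equal fibre sizes allow the original index set to be matched with the new one label by label,
  -- so that the change of basis is block diagonal.
  have hfib : ∀ k, Fintype.card {x // label x = k} = Fintype.card {p : J // (ε p.1).1 = k} := by
    intro k
    rw [← finrank_labelSubspace, ← hWdim k, Fintype.card_subtype]
    have : (Finset.univ.filter fun p : J => (ε p.1).1 = k) =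
        (Finset.univ.filter fun i => (ε i).1 = k).sigma fun _ => Finset.univ := by
      ext p
      rw [Finset.mem_filter, and_iff_right (Finset.mem_univ p)]
      exact ⟨fun h => Finset.mem_sigma.2
          ⟨Finset.mem_filter.2 ⟨Finset.mem_univ _, h⟩, Finset.mem_univ _⟩,
        fun h => (Finset.mem_filter.1 (Finset.mem_sigma.1 h).1).2⟩
    rw [this, Finset.card_sigma, Finset.sum_filter]
    simp only [Finset.card_univ, Fintype.card_fin, hblock]
    rw [ε.sum_comp fun a : α => if a.1 = k then finrank ℂ (Wα a) else 0, Fintype.sum_sigma,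
      Finset.sum_eq_single k]
    · simp [Wα]
    · intro k' _ hk'
      simp [hk']
    · simp
  let E : ∀ k, {x // label x = k} ≃ {p : J // (ε p.1).1 = k} :=
    fun k => Fintype.equivOfCardEq (hfib k)
  let e : n ≃ J := Equiv.ofFiberEquiv E
  have he : ∀ x, label x = (ε (e x).1).1 := fun x => (Equiv.ofFiberEquiv_map E x).symm
  let B₀ : J → n → ℂ := fun p => (b (ε p.1) p.2 : n → ℂ)
  have hspan : ⊤ ≤ Submodule.span ℂ (Set.range B₀) := by
    rw [← iSup_labelSubspace label]
    refine iSup_le fun k => ?_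
    rw [← hWsup k]
    refine iSup_le fun i => ?_
    have h1 : W k i = (⊤ : Submodule ℂ (W k i)).map (W k i).subtype :=
      (Submodule.map_subtype_top _).symm
    rw [h1, ← (b ⟨k, i⟩).span_eq, Submodule.map_span, Submodule.span_le]
    rintro _ ⟨_, ⟨j, rfl⟩, rfl⟩
    have h2 : ∀ a (ha : ε (ε.symm a) = a) (j : Fin (blockDim dim (c a))),
        (b a j : n → ℂ) ∈ Set.range B₀ := by
      intro a _
      obtain ⟨l, rfl⟩ := ε.surjective a
      exact fun j => ⟨⟨l, j⟩, rfl⟩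
    exact Submodule.subset_span (h2 ⟨k, i⟩ (ε.apply_symm_apply _) j)
  have hcard : Fintype.card J = finrank ℂ (n → ℂ) := by
    rw [finrank_fintype_fun_eq_card, Fintype.card_congr e]
  let B₁ : Basis J ℂ (n → ℂ) := basisOfTopLeSpanOfCardEqFinrank B₀ hspan hcard
  have hB₁ : ∀ p, B₁ p = B₀ p := fun p => by
    rw [coe_basisOfTopLeSpanOfCardEqFinrank]
  have hB : ∀ p, B₁.reindex e.symm (e.symm p) = B₀ p := fun p => by
    rw [Basis.reindex_apply, Equiv.symm_symm, Equiv.apply_symm_apply, hB₁]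
  have hB' : ∀ x, B₁.reindex e.symm x = B₀ (e x) := fun x => by
    rw [← hB, Equiv.symm_apply_apply]
  refine ⟨T * L, Nat.mul_pos hTpos hL, Fintype.card α, q, dim, fun k => c (ε k), e,
    fun k => (ε k).1, fun k => μ (ε k), B₁.reindex e.symm, M, hdim, hε, he, fun x => ?_,
    fun k => hμ _, fun j => ?_, hMnone, fun m hm x hx y => ?_, fun m hm Y hY => ?_⟩
  · rw [hB', he x, ← hWsup]
    exact Submodule.mem_iSup_of_mem (ε (e x).1).2 (b (ε (e x).1) (e x).2).2
  · obtain ⟨a, ha⟩ := hreal j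
    exact ⟨ε.symm a, by simpa using ha⟩
  · rw [hB']
    have := hact m hm x (by rw [← pow_mul S, ← mul_assoc]; exact hx) (ε (e y).1) (e y).2
    refine this.trans (Finset.sum_congr rfl fun i' _ => ?_)
    rw [hB]
  · obtain ⟨x, hx, h⟩ := hlift m hm Y hY
    refine ⟨x, ?_, h⟩
    rw [← pow_mul S, ← mul_assoc] at hx
    exact hx

end AdaptedBasisMatrix

/-! ### From matrices to operators, and free diagonal blocks -/

section CanonicalForm

theorem span_range_listProd {ι A : Type*} [Ring A] [Algebra ℂ A] (a : ι → A) (ℓ : ℕ) :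
    Submodule.span ℂ (Set.range fun w : Fin ℓ → ι => (List.ofFn fun k => a (w k)).prod) =
      Submodule.span ℂ (Set.range a) ^ ℓ := by
  rw [Submodule.span_pow]
  congr 1
  ext x
  rw [Set.mem_pow]
  constructor
  · rintro ⟨w, rfl⟩
    exact ⟨fun k => ⟨a (w k), w k, rfl⟩, rfl⟩
  · rintro ⟨f, rfl⟩
    choose w hw using fun k => (f k).2
    exact ⟨w, by simp only [hw]⟩

variable {ι n κ : Type*} [Fintype n] [DecidableEq n]

theorem span_range_blockSites (T : ι → Matrix n n ℂ) (ℓ : ℕ) :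
    Submodule.span ℂ (Set.range (blockSites T ℓ)) = Submodule.span ℂ (Set.range T) ^ ℓ :=
  span_range_listProd T ℓ

/-- The operators spanned by the matrices of a tensor. -/
noncomputable def operatorSpan (T : ι → Matrix n n ℂ) : Submodule ℂ (End ℂ (n → ℂ)) :=
  (Submodule.span ℂ (Set.range T)).map (toLinAlgEquiv' : _ ≃ₐ[ℂ] _).toAlgHom.toLinearMap

theorem mem_operatorSpan_pow {T : ι → Matrix n n ℂ} {ℓ : ℕ} {x : End ℂ (n → ℂ)} :
    x ∈ operatorSpan T ^ ℓ ↔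
      ∃ X ∈ Submodule.span ℂ (Set.range (blockSites T ℓ)), toLinAlgEquiv' X = x := by
  rw [operatorSpan, ← Submodule.map_pow, span_range_blockSites]
  rfl

/-- Block diagonality makes the coordinate subspace of a label invariant, and extension by zero
intertwines the diagonal block with the action there. -/
theorem isIrreducibleOn_operatorSpan [DecidableEq κ] {T : ι → Matrix n n ℂ} {label : n → κ}
    (hdiag : ∀ i, IsLabelDiagonal label (T i)) {k : κ}
    (hirr : IsIrreducibleFamily fun i => (T i).toSquareBlock label k) :
    IsIrreducibleOn (operatorSpan T) (labelSubspace label k) := by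
  have hinv : ∀ i, ∀ v ∈ labelSubspace label k, T i *ᵥ v ∈ labelSubspace label k := by
    intro i v hv x hx
    refine Finset.sum_eq_zero fun y _ => ?_
    by_cases hy : label y = k
    · exact mul_eq_zero_of_left (hdiag i x y (by rw [hy]; exact hx)) _
    · exact mul_eq_zero_of_right _ (hv y hy)
  have hgen : ∀ W : Submodule ℂ (n → ℂ), (∀ i, ∀ v ∈ W, T i *ᵥ v ∈ W) ↔
      ∀ x ∈ operatorSpan T, x ∈ stabilizer W := by
    intro W
    constructor
    · intro h
      have : operatorSpan T ≤ Subalgebra.toSubmodule (stabilizer W) := by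
        rw [operatorSpan, Submodule.map_span, Submodule.span_le]
        rintro _ ⟨_, ⟨i, rfl⟩, rfl⟩
        exact fun v hv => h i v hv
      exact this
    · intro h i v hv
      exact h _ ⟨T i, Submodule.subset_span ⟨i, rfl⟩, rfl⟩ v hv
  refine ⟨?_, (hgen _).1 hinv, fun W hW hWinv => ?_⟩
  · obtain ⟨x⟩ := hirr.1
    refine (Submodule.ne_bot_iff _).2 ⟨Pi.single x.1 1, fun y hy => ?_, ?_⟩
    · exact Pi.single_eq_of_ne (fun h => hy (by rw [h]; exact x.2)) _
    · exact fun h => one_ne_zero ((Pi.single_eq_zero_iff).1 h)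
  · rw [← hgen] at hWinv
    let E := labelEquiv label k
    have hE : ∀ i w, ((E.symm ((T i).toSquareBlock label k *ᵥ w) : labelSubspace label k) : n → ℂ)
        = T i *ᵥ (E.symm w).1 := by
      intro i w
      obtain ⟨v, rfl⟩ := E.surjective w
      have : (T i).toSquareBlock label k *ᵥ E v = E ⟨T i *ᵥ v.1, hinv i v.1 v.2⟩ := by
        ext x
        change ∑ y : {y // label y = k}, T i x y * v.1 y = ∑ y, T i x y * v.1 y
        rw [← Fintype.sum_subtype_add_sum_subtype (fun y => label y = k), left_eq_add]
        exact Finset.sum_eq_zero fun y _ => by rw [v.2 y.1 y.2, mul_zero]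
      rw [this, LinearEquiv.symm_apply_apply, LinearEquiv.symm_apply_apply]
    let W' : Submodule ℂ ({x // label x = k} → ℂ) :=
      W.comap ((labelSubspace label k).subtype ∘ₗ E.symm.toLinearMap)
    have hW' : ∀ w, w ∈ W' ↔ (E.symm w : n → ℂ) ∈ W := fun _ => Iff.rfl
    rcases hirr.2 W' fun i w hw => by
      rw [hW', hE]; exact hWinv i _ hw with h | h
    · left
      rw [eq_bot_iff]
      intro v hv
      have : E ⟨v, hW hv⟩ ∈ W' := by rw [hW', LinearEquiv.symm_apply_apply]; exact hv
      rw [h, Submodule.mem_bot, LinearEquiv.map_eq_zero_iff] at this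
      exact congrArg Subtype.val this
    · right
      refine le_antisymm hW fun v hv => ?_
      have : E ⟨v, hv⟩ ∈ W' := by rw [h]; trivial
      rwa [hW', LinearEquiv.symm_apply_apply] at this

/-- The matrix supported in the diagonal sector `(j, j)` with the given block. -/
noncomputable def sectorBlock {q : ℕ} {dim : Fin q → ℕ} (j : Fin q) :
    (∀ o : Option (Fin q), Matrix (Fin (blockDim dim o)) (Fin (blockDim dim o)) ℂ) →ₗ[ℂ]
      Matrix (Σ o, Fin (blockDim dim o)) (Σ o, Fin (blockDim dim o)) ℂ where
  toFun N := blockDiagonal' fun o => if o = some j then N o else 0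
  map_add' N N' := by
    rw [← blockDiagonal'_add]
    congr 1
    ext o : 1
    by_cases h : o = some j <;> simp [h]
  map_smul' c N := by
    rw [RingHom.id_apply, ← blockDiagonal'_smul]
    congr 1
    ext o : 1
    by_cases h : o = some j <;> simp [h]

theorem sectorBlock_apply_eq {q : ℕ} {dim : Fin q → ℕ} (j : Fin q)
    (N : ∀ o : Option (Fin q), Matrix (Fin (blockDim dim o)) (Fin (blockDim dim o)) ℂ)
    (o : Option (Fin q)) (i i' : Fin (blockDim dim o)) :
    sectorBlock j N ⟨o, i⟩ ⟨o, i'⟩ = if o = some j then N o i i' else 0 := by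
  refine (blockDiagonal'_apply_eq (fun o => if o = some j then N o else 0) o i i').trans ?_
  by_cases h : o = some j <;> simp [h]

theorem sectorBlock_apply_ne {q : ℕ} {dim : Fin q → ℕ} (j : Fin q)
    (N : ∀ o : Option (Fin q), Matrix (Fin (blockDim dim o)) (Fin (blockDim dim o)) ℂ)
    {x y : Σ o, Fin (blockDim dim o)} (h : x.1 ≠ y.1) : sectorBlock j N x y = 0 :=
  blockDiagonal'_apply_ne (fun o => if o = some j then N o else 0) x.2 y.2 h

theorem sum_sectorBlock {q : ℕ} {dim : Fin q → ℕ}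
    {N : ∀ o : Option (Fin q), Matrix (Fin (blockDim dim o)) (Fin (blockDim dim o)) ℂ}
    (hN : N none = 0) (c : ℂ) (o : Option (Fin q)) (i i' : Fin (blockDim dim o)) :
    ∑ j, (if o = some j then c else 0) * sectorBlock j N ⟨o, i⟩ ⟨o, i'⟩ = c * N o i i' := by
  cases o with
  | none => simp [hN]
  | some j =>
    rw [Finset.sum_eq_single j]
    · rw [sectorBlock_apply_eq, if_pos rfl, if_pos rfl]
    · intro j' _ hj'
      rw [if_neg fun h => hj' (Option.some_injective _ h).symm, zero_mul]
    · exact fun h => absurd (Finset.mem_univ j) h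

end CanonicalForm

/-! ### Existence of a matrix canonical form -/

section CanonicalForm

variable {ι n κ : Type*} [Fintype n] [DecidableEq n] [LinearOrder κ]

/-- Block diagonal means block triangular for both the order and its dual, and each kind of
triangularity passes to the inverse. -/
theorem isLabelDiagonal_toMatrix_basisFun (label : n → κ) (B : Basis n ℂ (n → ℂ))
    (hB : ∀ x, B x ∈ labelSubspace label (label x)) :
    IsLabelDiagonal label (B.toMatrix (Pi.basisFun ℂ n)) := by
  set Q := (Pi.basisFun ℂ n).toMatrix B with hQ
  have hQ0 : ∀ x y, label x ≠ label y → Q x y = 0 := fun x y h => hB y x h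
  have : Invertible Q := invertibleOfLeftInverse _ _ (B.toMatrix_mul_toMatrix_flip (Pi.basisFun ℂ n))
  have hinv : B.toMatrix (Pi.basisFun ℂ n) = Q⁻¹ :=
    (inv_eq_left_inv (B.toMatrix_mul_toMatrix_flip (Pi.basisFun ℂ n))).symm
  intro x y hxy
  rw [hinv]
  rcases lt_or_gt_of_ne hxy with h | h
  · refine blockTriangular_inv_of_blockTriangular (M := Q) (b := OrderDual.toDual ∘ label)
      (fun a b hab => hQ0 a b fun h' => ?_) h
    exact absurd (congrArg OrderDual.toDual h') (ne_of_gt hab)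
  · exact blockTriangular_inv_of_blockTriangular (M := Q) (b := label)
      (fun a b hab => hQ0 a b (ne_of_gt hab)) h

/-- A block diagonal tensor with irreducible blocks has, after blocking and a block diagonal gauge
transformation, a matrix canonical form refining its blocks. -/
theorem exists_matrixCF_refines {T : ι → Matrix n n ℂ} {label : n → κ}
    (hdiag : ∀ i, IsLabelDiagonal label (T i))
    (hirr : ∀ k, IsIrreducibleFamily fun i => (T i).toSquareBlock label k) :
    ∃ L, 1 ≤ L ∧ ∃ P : (Matrix n n ℂ)ˣ, IsLabelDiagonal label P.val ∧ ∀ m, 1 ≤ m →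
      ∃ cf : MatrixCF (gauge P (blockSites T (L * m))), cf.Refines label := by
  obtain ⟨L, hL, s, q, dim, cls, e, f, μ, B, M, hdim, hf, he, hB, hμ, hreal, hMnone, hact, hlift⟩ :=
    exists_adapted_basis label fun k => isIrreducibleOn_operatorSpan hdiag (hirr k)
  let P : (Matrix n n ℂ)ˣ :=
    { val := B.toMatrix (Pi.basisFun ℂ n)
      inv := (Pi.basisFun ℂ n).toMatrix B
      val_inv := B.toMatrix_mul_toMatrix_flip _
      inv_val := (Pi.basisFun ℂ n).toMatrix_mul_toMatrix_flip _ }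
  refine ⟨L, hL, P, isLabelDiagonal_toMatrix_basisFun label B hB, fun m hm => ?_⟩
  have hentry : ∀ X ∈ Submodule.span ℂ (Set.range (blockSites T (L * m))), ∀ x y,
      (P.val * X * P.inv) x y = ∑ i', if ⟨(e y).1, i'⟩ = e x then
        μ (e y).1 ^ m * M (toLinAlgEquiv' X) (cls (e y).1) i' (e y).2 else 0 := by
    intro X hX x y
    have h1 : P.val * X * P.inv = LinearMap.toMatrix B B (toLin' X) := by
      rw [← basis_toMatrix_mul_linearMap_toMatrix_mul_basis_toMatrix (b := B) (c := B)
        (b' := Pi.basisFun ℂ n) (c' := Pi.basisFun ℂ n), LinearMap.toMatrix_eq_toMatrix',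
        LinearMap.toMatrix'_toLin']
    rw [h1, LinearMap.toMatrix_apply]
    have h2 := hact m hm (toLinAlgEquiv' X) (mem_operatorSpan_pow.2 ⟨X, hX, rfl⟩) y
    have h3 : toLin' X (B y) = toLinAlgEquiv' X (B y) := rfl
    rw [h3, h2, map_sum, Finsupp.finsetSum_apply]
    refine Finset.sum_congr rfl fun i' _ => ?_
    rw [map_smul, Basis.repr_self, Finsupp.smul_single, smul_eq_mul, mul_one,
      Finsupp.single_apply]
    simp only [Equiv.symm_apply_eq]
  -- Total reducibility leaves no off-diagonal free blocks. The coefficients are `μ k ^ m`, so a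
  -- representative, where `μ k = 1`, keeps coefficient 1 for every `m`.
  let up : Fin q ⊕ Fin 0 → (Fin (L * m) → ι) →
      Matrix (Σ o, Fin (blockDim dim o)) (Σ o, Fin (blockDim dim o)) ℂ := fun t w =>
    Sum.elim (fun j => sectorBlock j (M (toLinAlgEquiv' (blockSites T (L * m) w)))) Fin.elim0 t
  let low : Fin q ⊕ Fin 0 → Matrix (Fin s) (Fin s) ℂ := fun t k l =>
    Sum.elim (fun j => if k = l then (if cls k = some j then μ k ^ m else 0) else 0) Fin.elim0 t
  have hlow : ∀ j k, low (.inl j) k k = if cls k = some j then μ k ^ m else 0 :=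
    fun j k => if_pos rfl
  have hlow' : ∀ t k l, k ≠ l → low t k l = 0 := by
    rintro (j | j) k l h
    · exact if_neg h
    · exact j.elim0
  have hsum : ∀ w (p p' : Σ k : Fin s, Fin (blockDim dim (cls k))),
      (∑ i', if ⟨p'.1, i'⟩ = p then μ p'.1 ^ m *
        M (toLinAlgEquiv' (blockSites T (L * m) w)) (cls p'.1) i' p'.2 else 0) =
      ∑ t, low t p.1 p'.1 * up t w ⟨cls p.1, p.2⟩ ⟨cls p'.1, p'.2⟩ := by
    rintro w ⟨k, i⟩ ⟨l, i'⟩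
    rw [Fintype.sum_sum_type, Finset.univ_eq_empty (α := Fin 0), Finset.sum_empty, add_zero]
    by_cases hkl : k = l
    · subst hkl
      rw [Finset.sum_eq_single i]
      · rw [if_pos rfl, ← sum_sectorBlock (hMnone _)]
        exact Finset.sum_congr rfl fun j _ => by rw [hlow]; rfl
      · intro i'' _ h
        rw [if_neg]
        simpa using h
      · exact fun h => absurd (Finset.mem_univ i) h
    · rw [Finset.sum_eq_zero, Finset.sum_eq_zero]
      · intro j _
        rw [hlow' _ _ _ hkl, zero_mul]
      · intro i'' _
        rw [if_neg]
        intro h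
        exact hkl (congrArg Sigma.fst h).symm
  have hassemble : gauge P (blockSites T (L * m)) = assemble e up low := by
    funext w x y
    exact (hentry _ (Submodule.subset_span ⟨w, rfl⟩) x y).trans (hsum w (e x) (e y))
  refine ⟨{ q := q, g := 0, dim := dim, dim_pos := hdim, sector := Fin.elim0, s := s, cls := cls,
            e := e, up := up, low := low, eq_assemble := hassemble,
            low_upper := fun t k l h => hlow' t k l (ne_of_gt h)
            low_sector := ?_
            low_diag_inr := fun f => f.elim0
            low_diag_inl := ?_
            realized_inl := ?_
            realized_inr := fun f => f.elim0
            block_injective := ?_ }, f, hf, he⟩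
  · rintro (j | j) k l h
    · by_cases hkl : k = l
      · subst hkl
        rw [hlow] at h
        have hc : cls k = some j := by
          by_contra hne
          exact h (if_neg hne)
        rw [hc]; rfl
      · exact absurd (hlow' _ _ _ hkl) h
    · exact j.elim0
  · intro j k h
    rw [hlow, if_pos h]
    exact pow_ne_zero m (hμ k)
  · intro j
    obtain ⟨k, hk, hk1⟩ := hreal j
    refine ⟨k, ?_⟩
    rintro (j' | j')
    · rw [hlow, hk, hk1, one_pow]
      by_cases h : j = j'
      · subst h; simp
      · rw [if_neg fun h' => h (Option.some_injective _ h'),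
          if_neg fun h' => h (Sum.inl_injective h').symm]
    · exact j'.elim0
  · intro F
    -- Reading off the free blocks is linear, so the span of the tuples is the image of the span of
    -- words, to which `hlift` applies.
    let Λ : Matrix n n ℂ →ₗ[ℂ] (Fin q ⊕ Fin 0 →
        Matrix (Σ o, Fin (blockDim dim o)) (Σ o, Fin (blockDim dim o)) ℂ) :=
      LinearMap.pi fun t => Sum.elim (fun j => sectorBlock j ∘ₗ M ∘ₗ
        (toLinAlgEquiv' : Matrix n n ℂ ≃ₐ[ℂ] _).toLinearMap) Fin.elim0 t
    have hΛ : ∀ X j, Λ X (.inl j) = sectorBlock j (M (toLinAlgEquiv' X)) := fun _ _ => rfl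
    have hspan : Submodule.span ℂ (Set.range fun w => fun t => up t w) =
        (Submodule.span ℂ (Set.range (blockSites T (L * m)))).map Λ := by
      rw [Submodule.map_span, ← Set.range_comp]
      congr 2
      funext w t
      rcases t with j | j
      · rfl
      · exact j.elim0
    rw [hspan]
    constructor
    · rintro ⟨X, -, rfl⟩ (j | j) ⟨o, i⟩ ⟨o', i'⟩ h
      · rw [hΛ] at h
        by_cases ho : o = o'
        · subst ho
          rw [sectorBlock_apply_eq] at h
          have hc : o = some j := by
            by_contra hne
            exact h (if_neg hne)
          subst hc
          rfl
        · exact absurd (sectorBlock_apply_ne j _ ho) h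
      · exact j.elim0
    · intro h
      obtain ⟨x, hx, hxN⟩ := hlift m hm (fun o => match o with
        | none => 0
        | some j => fun i i' => F (.inl j) ⟨some j, i⟩ ⟨some j, i'⟩) rfl
      obtain ⟨X, hX, rfl⟩ := mem_operatorSpan_pow.1 hx
      refine ⟨X, hX, funext fun t => ?_⟩
      rcases t with j | j
      · ext ⟨o, i⟩ ⟨o', i'⟩
        rw [hΛ, hxN]
        by_cases ho : o = some j ∧ o' = some j
        · obtain ⟨rfl, rfl⟩ := ho
          rw [sectorBlock_apply_eq, if_pos rfl]
        · have hF : F (.inl j) ⟨o, i⟩ ⟨o', i'⟩ = 0 := by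
            by_contra hne
            have := h (.inl j) _ _ hne
            exact ho ⟨congrArg Prod.fst this, congrArg Prod.snd this⟩
          rw [hF]
          by_cases hoo : o = o'
          · subst hoo
            rw [sectorBlock_apply_eq, if_neg fun h' => ho ⟨h', h'⟩]
          · exact sectorBlock_apply_ne j _ hoo
      · exact j.elim0

end CanonicalForm

/-! ### Free diagonal blocks are not negligible -/

section Negligible

variable {n : Type*} [Fintype n] [DecidableEq n]

theorem isNilpotent_matrix_of_trace_pow_eq_zero (M : Matrix n n ℂ)
    (h : ∀ k, 1 ≤ k → (M ^ k).trace = 0) : IsNilpotent M := by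
  have := MPSX.isNilpotent_of_trace_pow_eq_zero (toLinAlgEquiv' M) fun k hk => by
    rw [← map_pow]
    exact (trace_toLin'_eq (M ^ k)).trans (h k hk)
  exact (IsNilpotent.map_iff (f := (toLinAlgEquiv' : Matrix n n ℂ ≃ₐ[ℂ] _))
    (toLinAlgEquiv').injective).1 this

theorem isNilpotent_of_strictlyUpper {s : ℕ} (b : n → Fin s) {M : Matrix n n ℂ}
    (h : ∀ x y, M x y ≠ 0 → b x < b y) : IsNilpotent M := by
  have hpow : ∀ (k : ℕ) (x y : n), (M ^ k) x y ≠ 0 → (b x : ℕ) + k ≤ b y := by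
    intro k
    induction k with
    | zero =>
      intro x y hxy
      rw [pow_zero] at hxy
      obtain rfl : x = y := by
        by_contra hne
        exact hxy (one_apply_ne hne)
      exact le_rfl
    | succ k ih =>
      intro x y hxy
      rw [pow_succ, mul_apply] at hxy
      obtain ⟨z, -, hz⟩ := Finset.exists_ne_zero_of_sum_ne_zero hxy
      have h1 := ih x z (left_ne_zero_of_mul hz)
      have h2 : (b z : ℕ) < b y := h z y (right_ne_zero_of_mul hz)
      omega
  refine ⟨s, ?_⟩
  ext x y
  by_contra hne
  have := hpow s x y hne
  have := (b y).2
  omega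

/-- Powers of a matrix that is triangular for a strict preorder on its index set. -/
theorem pow_apply_self_of_upper {s : ℕ} (b : n → Fin s) {M : Matrix n n ℂ}
    (h : ∀ x y, M x y ≠ 0 → b x < b y ∨ x = y) (k : ℕ) (x : n) : (M ^ k) x x = M x x ^ k := by
  have hpow : ∀ (k : ℕ) (x y : n), (M ^ k) x y ≠ 0 → b x < b y ∨ x = y := by
    intro k
    induction k with
    | zero =>
      intro x y hxy
      rw [pow_zero] at hxy
      by_contra hne
      exact hxy (one_apply_ne (not_or.1 hne).2)
    | succ k ih =>
      intro x y hxy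
      rw [pow_succ, mul_apply] at hxy
      obtain ⟨z, -, hz⟩ := Finset.exists_ne_zero_of_sum_ne_zero hxy
      rcases ih x z (left_ne_zero_of_mul hz) with h1 | rfl
      · rcases h z y (right_ne_zero_of_mul hz) with h2 | rfl
        · exact Or.inl (h1.trans h2)
        · exact Or.inl h1
      · exact h _ _ (right_ne_zero_of_mul hz)
  induction k with
  | zero => rw [pow_zero, pow_zero, one_apply_eq]
  | succ k ih =>
    rw [pow_succ, mul_apply, Finset.sum_eq_single x, ih, pow_succ]
    · intro z _ hz
      by_contra hne
      rcases hpow k x z (left_ne_zero_of_mul hne) with h1 | h1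
      · rcases h z x (right_ne_zero_of_mul hne) with h2 | h2
        · exact lt_asymm h1 h2
        · exact hz h2
      · exact hz h1.symm
    · exact fun h => absurd (Finset.mem_univ x) h

/-- Tensors generating the same periodic states have equal traces of corresponding linear
combinations of words. -/
theorem trace_eq_of_mem_span_pow {ω n' : Type*} [Fintype n'] [DecidableEq n']
    {A : ω → Matrix n n ℂ} {B : ω → Matrix n' n' ℂ}
    (h : ∀ N, 1 ≤ N → state 1 A N = state 1 B N) {N : ℕ} (hN : 1 ≤ N)
    {z : Matrix n n ℂ × Matrix n' n' ℂ}
    (hz : z ∈ Submodule.span ℂ (Set.range fun i => (A i, B i)) ^ N) : z.1.trace = z.2.trace := by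
  rw [← span_range_listProd] at hz
  induction hz using Submodule.span_induction with
  | mem z hz =>
    obtain ⟨w, rfl⟩ := hz
    have h1 := congrFun (h N hN) w
    rw [state, state, one_mul, one_mul, blockSites, blockSites] at h1
    have hA := map_list_prod (RingHom.fst (Matrix n n ℂ) (Matrix n' n' ℂ))
      (List.ofFn fun k => (A (w k), B (w k)))
    have hB := map_list_prod (RingHom.snd (Matrix n n ℂ) (Matrix n' n' ℂ))
      (List.ofFn fun k => (A (w k), B (w k)))
    rw [List.map_ofFn] at hA hB
    exact (congrArg trace hA).trans (h1.trans (congrArg trace hB).symm)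
  | zero => simp
  | add x y _ _ hx hy => rw [Prod.fst_add, Prod.snd_add, trace_add, trace_add, hx, hy]
  | smul a x _ hx => rw [Prod.smul_fst, Prod.smul_snd, trace_smul, trace_smul, hx]

variable {ω : Type*} {T : ω → Matrix n n ℂ}

omit [Fintype n] [DecidableEq n] in
theorem MatrixCF.blockDim_pos (cf : MatrixCF T) (o : Option (Fin cf.q)) :
    0 < blockDim cf.dim o := by
  cases o with
  | none => exact Nat.one_pos
  | some j => exact cf.dim_pos j

omit [Fintype n] [DecidableEq n] in
/-- A linear combination of the matrices of the tensor, obtained by prescribing a single free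
block. -/
theorem MatrixCF.exists_sum_eq (cf : MatrixCF T) [Fintype ω] (t : Fin cf.q ⊕ Fin cf.g)
    (Y : Matrix (Σ o, Fin (blockDim cf.dim o)) (Σ o, Fin (blockDim cf.dim o)) ℂ)
    (hY : ∀ x y, Y x y ≠ 0 → (x.1, y.1) = sectorOf cf.sector t) :
    ∃ c : ω → ℂ, (∀ x y, (∑ i, c i • T i) x y = cf.low t (cf.e x).1 (cf.e y).1 *
        Y ⟨cf.cls (cf.e x).1, (cf.e x).2⟩ ⟨cf.cls (cf.e y).1, (cf.e y).2⟩) ∧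
      ∑ i, c i • assemble cf.e (Function.update cf.up t 0) cf.low i = 0 := by
  have hmem := (cf.block_injective (Pi.single t Y)).2 fun t' x y hne => by
    by_cases h : t' = t
    · subst h
      rw [Pi.single_eq_same] at hne
      exact hY x y hne
    · rw [Pi.single_eq_of_ne h] at hne
      exact absurd rfl hne
  obtain ⟨c, hc⟩ := (Submodule.mem_span_range_iff_exists_fun ℂ).1 hmem
  have hc' : ∀ t' x y, ∑ i, c i * cf.up t' i x y =
      (Pi.single t Y : Fin cf.q ⊕ Fin cf.g → Matrix _ _ ℂ) t' x y := fun t' x y => by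
    rw [← hc]
    simp [Finset.sum_apply, Matrix.sum_apply]
  have hgen : ∀ (up : Fin cf.q ⊕ Fin cf.g → ω → Matrix (Σ o, Fin (blockDim cf.dim o))
      (Σ o, Fin (blockDim cf.dim o)) ℂ) x y, (∑ i, c i • assemble cf.e up cf.low i) x y =
      ∑ t', cf.low t' (cf.e x).1 (cf.e y).1 * ∑ i, c i *
        up t' i ⟨cf.cls (cf.e x).1, (cf.e x).2⟩ ⟨cf.cls (cf.e y).1, (cf.e y).2⟩ := by
    intro up x y
    simp only [Matrix.sum_apply, Matrix.smul_apply, assemble, smul_eq_mul, Finset.mul_sum]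
    rw [Finset.sum_comm]
    exact Finset.sum_congr rfl fun t' _ => Finset.sum_congr rfl fun i _ => by ring
  refine ⟨c, fun x y => ?_, ?_⟩
  · conv_lhs => rw [cf.eq_assemble]
    rw [hgen, Finset.sum_eq_single t]
    · rw [hc', Pi.single_eq_same]
    · intro t' _ h
      rw [hc', Pi.single_eq_of_ne h, Matrix.zero_apply, mul_zero]
    · exact fun h => absurd (Finset.mem_univ t) h
  · ext x y
    rw [hgen]
    refine Finset.sum_eq_zero fun t' _ => ?_
    by_cases h : t' = t
    · subst h
      rw [Function.update_self]
      simp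
    · rw [Function.update_of_ne h, hc', Pi.single_eq_of_ne h, Matrix.zero_apply, mul_zero]

/-- Free diagonal blocks are not negligible for the trivial boundary. -/
theorem MatrixCF.not_negligible_inl [Fintype ω] (cf : MatrixCF T) (j : Fin cf.q) :
    ¬ cf.Negligible 1 (.inl j) := by
  intro hneg
  -- The prescribed block is the identity on class `j`. The same combination vanishes once free
  -- block `j` is removed, so negligibility makes all powers of `N` traceless.
  obtain ⟨c, hc, hc0⟩ := cf.exists_sum_eq (.inl j)
    (Matrix.of fun x y => if x = y ∧ x.1 = some j then 1 else 0) fun x y hne => by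
      have h : x = y ∧ x.1 = some j := by
        by_contra h
        exact hne (if_neg h)
      obtain ⟨rfl, h⟩ := h
      rw [h]; rfl
  set N := ∑ i, c i • T i with hN
  have hnil : IsNilpotent N := by
    refine isNilpotent_matrix_of_trace_pow_eq_zero N fun k hk => ?_
    have hz : ((0 : Matrix n n ℂ), N) ∈ Submodule.span ℂ (Set.range fun i =>
        (assemble cf.e (Function.update cf.up (.inl j) 0) cf.low i, T i)) := by
      have : ((0 : Matrix n n ℂ), N) = ∑ i, c i •
          (assemble cf.e (Function.update cf.up (.inl j) 0) cf.low i, T i) := by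
        refine Prod.ext ?_ ?_
        · rw [Prod.fst_sum, ← hc0]; rfl
        · rw [Prod.snd_sum]; rfl
      rw [this]
      exact sum_mem fun i _ => Submodule.smul_mem _ _ (Submodule.subset_span ⟨i, rfl⟩)
    have := trace_eq_of_mem_span_pow hneg hk (Submodule.pow_mem_pow _ hz k)
    rw [Prod.pow_fst, Prod.pow_snd, zero_pow (by omega), trace_zero] at this
    exact this.symm
  obtain ⟨k, hk⟩ := cf.realized_inl j
  have hlow : cf.low (.inl j) k k = 1 := by rw [hk, if_pos rfl]
  have hcls : cf.cls k = some j :=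
    congrArg Prod.fst (cf.low_sector (.inl j) k k (by rw [hlow]; exact one_ne_zero))
  let x : n := cf.e.symm ⟨k, ⟨0, cf.blockDim_pos _⟩⟩
  have hxk : (cf.e x).1 = k := by rw [Equiv.apply_symm_apply]
  have hx : N x x = 1 := by
    rw [hc, Matrix.of_apply, if_pos ⟨rfl, (congrArg cf.cls hxk).trans hcls⟩, mul_one, hxk, hlow]
  -- Since the prescribed block is diagonal, `N` is triangular entrywise and not only blockwise, so
  -- its powers have the powers of its diagonal entries on the diagonal.
  have hupper : ∀ x y, N x y ≠ 0 → (cf.e x).1 < (cf.e y).1 ∨ x = y := by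
    intro x y hne
    rw [hc] at hne
    have h1 := left_ne_zero_of_mul hne
    have h2 := right_ne_zero_of_mul hne
    rcases lt_trichotomy (cf.e x).1 (cf.e y).1 with h | h | h
    · exact Or.inl h
    · right
      have h3 : (⟨cf.cls (cf.e x).1, (cf.e x).2⟩ : Σ o, Fin (blockDim cf.dim o)) =
          ⟨cf.cls (cf.e y).1, (cf.e y).2⟩ := by
        by_contra h4
        exact h2 (if_neg fun h5 => h4 h5.1)
      refine cf.e.injective ?_
      generalize cf.e x = p at h h3 ⊢
      generalize cf.e y = p' at h h3 ⊢
      obtain ⟨a, i⟩ := p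
      obtain ⟨a', i'⟩ := p'
      obtain rfl : a = a' := h
      simpa using h3
    · exact absurd (cf.low_upper _ _ _ h) h1
  obtain ⟨m, hm⟩ := hnil
  have := pow_apply_self_of_upper (fun x => (cf.e x).1) hupper m x
  rw [hm, hx, one_pow, Matrix.zero_apply] at this
  exact zero_ne_one this

end Negligible

/-! ### Absence of off-diagonal free blocks -/

section Negligible

variable {ι n κ : Type*} [Fintype n] [DecidableEq n]

/-- In a gauge in which the blocked tensor is in matrix canonical form, all operators generated by
it are block upper triangular. -/
theorem MatrixCF.blockTriangular_of_mem_adjoin {T : ι → Matrix n n ℂ} {ℓ : ℕ}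
    {P : (Matrix n n ℂ)ˣ} (cf : MatrixCF (gauge P (blockSites T ℓ))) {r : End ℂ (n → ℂ)}
    (hr : r ∈ Algebra.adjoin ℂ ((operatorSpan T ^ ℓ : Submodule ℂ (End ℂ (n → ℂ))) : Set _)) :
    ∃ R, toLinAlgEquiv' R = r ∧ (P.val * R * P.inv).BlockTriangular fun x => (cf.e x).1 := by
  induction hr using Algebra.adjoin_induction with
  | mem r hr =>
    obtain ⟨R, hR, rfl⟩ := mem_operatorSpan_pow.1 hr
    refine ⟨R, rfl, ?_⟩
    clear hr
    induction hR using Submodule.span_induction with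
    | mem R hR =>
      obtain ⟨w, rfl⟩ := hR
      intro x y hxy
      refine (congrFun (congrFun (congrFun cf.eq_assemble w) x) y).trans ?_
      exact Finset.sum_eq_zero fun t _ => by rw [cf.low_upper _ _ _ hxy, zero_mul]
    | zero => rw [mul_zero, zero_mul]; exact blockTriangular_zero
    | add R R' _ _ h h' => rw [mul_add, add_mul]; exact h.add h'
    | smul a R _ h =>
      rw [Matrix.mul_smul, Matrix.smul_mul]
      exact fun x y hxy => by rw [Matrix.smul_apply, h hxy, smul_zero]
  | algebraMap a =>
    refine ⟨algebraMap ℂ _ a, AlgEquiv.commutes _ a, ?_⟩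
    rw [Algebra.algebraMap_eq_smul_one, Matrix.mul_smul, Matrix.smul_mul, mul_one, P.val_inv]
    intro x y hxy
    have h1 : (1 : Matrix n n ℂ) x y = 0 := one_apply_ne fun h => by
      subst h
      exact lt_irrefl _ hxy
    rw [Matrix.smul_apply, h1, smul_zero]
  | add r r' _ _ h h' =>
    obtain ⟨R, rfl, h⟩ := h
    obtain ⟨R', rfl, h'⟩ := h'
    exact ⟨R + R', map_add _ _ _, by rw [mul_add, add_mul]; exact h.add h'⟩
  | mul r r' _ _ h h' =>
    obtain ⟨R, rfl, h⟩ := h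
    obtain ⟨R', rfl, h'⟩ := h'
    refine ⟨R * R', map_mul _ _ _, ?_⟩
    have : P.val * (R * R') * P.inv = P.val * R * P.inv * (P.val * R' * P.inv) := by
      calc _ = P.val * R * 1 * R' * P.inv := by simp only [mul_assoc, one_mul]
        _ = _ := by rw [← P.inv_val]; simp only [mul_assoc]
    rw [this]
    exact h.mul h'

/-- A matrix canonical form of a block diagonal tensor with irreducible blocks has no free
off-diagonal blocks. -/
theorem MatrixCF.isEmpty_fin_g [Fintype ι] [DecidableEq κ] {T : ι → Matrix n n ℂ} {label : n → κ}
    (hdiag : ∀ i, IsLabelDiagonal label (T i))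
    (hirr : ∀ k, IsIrreducibleFamily fun i => (T i).toSquareBlock label k) {ℓ : ℕ} (hℓ : 1 ≤ ℓ)
    {P : (Matrix n n ℂ)ˣ} (cf : MatrixCF (gauge P (blockSites T ℓ))) : IsEmpty (Fin cf.g) := by
  refine ⟨fun f => ?_⟩
  -- Filling the sector of `f` with ones makes the entries of the gauged `N` equal to the
  -- coefficients of `f`, which vanish on and below the block diagonal.
  obtain ⟨c, hc, -⟩ := cf.exists_sum_eq (.inr f)
    (Matrix.of fun x y => if (x.1, y.1) = sectorOf cf.sector (.inr f) then 1 else 0)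
    fun x y hne => by
      by_contra h
      exact hne (if_neg h)
  set N := ∑ w, c w • blockSites T ℓ w with hN
  have hgauge : ∑ w, c w • gauge P (blockSites T ℓ) w = P.val * N * P.inv := by
    rw [hN, Finset.mul_sum, Finset.sum_mul]
    exact Finset.sum_congr rfl fun w _ => by rw [Matrix.mul_smul, Matrix.smul_mul]; rfl
  have hentry : ∀ x y, (P.val * N * P.inv) x y = cf.low (.inr f) (cf.e x).1 (cf.e y).1 := by
    intro x y
    rw [← hgauge, hc]
    by_cases h : cf.low (.inr f) (cf.e x).1 (cf.e y).1 = 0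
    · rw [h, zero_mul]
    · rw [Matrix.of_apply, if_pos (cf.low_sector _ _ _ h), mul_one]
  have hNmem : N ∈ Submodule.span ℂ (Set.range (blockSites T ℓ)) :=
    sum_mem fun w _ => Submodule.smul_mem _ _ (Submodule.subset_span ⟨w, rfl⟩)
  have hmem : toLinAlgEquiv' N ∈ operatorSpan T ^ ℓ := mem_operatorSpan_pow.2 ⟨N, hNmem, rfl⟩
  -- Strictly upper times upper triangular is nilpotent, so the vanishing principle applies; the
  -- position where `f` occurs with coefficient 1 then gives the contradiction.
  have hzero : toLinAlgEquiv' N = 0 := by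
    refine eq_zero_of_isNilpotent_mul_adjoin_pow
      (fun k => isIrreducibleOn_operatorSpan hdiag (hirr k)) (iSup_labelSubspace label) hℓ
      (Algebra.subset_adjoin hmem) fun r hr => ?_
    obtain ⟨R, rfl, hR⟩ := cf.blockTriangular_of_mem_adjoin hr
    rw [← map_mul]
    refine IsNilpotent.map ?_ _
    obtain ⟨m, hm⟩ : IsNilpotent (P.val * (N * R) * P.inv) := by
      have : P.val * (N * R) * P.inv = P.val * N * P.inv * (P.val * R * P.inv) := by
        calc _ = P.val * N * 1 * R * P.inv := by simp only [mul_assoc, one_mul]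
          _ = _ := by rw [← P.inv_val]; simp only [mul_assoc]
      rw [this]
      refine isNilpotent_of_strictlyUpper (fun x => (cf.e x).1) fun x y hxy => ?_
      rw [mul_apply] at hxy
      obtain ⟨z, -, hz⟩ := Finset.exists_ne_zero_of_sum_ne_zero hxy
      have h1 := left_ne_zero_of_mul hz
      have h2 : (cf.e z).1 ≤ (cf.e y).1 := by
        by_contra h
        exact right_ne_zero_of_mul hz (hR (not_le.1 h))
      rw [hentry] at h1
      refine lt_of_lt_of_le (lt_of_le_of_ne ?_ fun h => ?_) h2
      · by_contra h
        exact h1 (cf.low_upper _ _ _ (not_le.1 h))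
      · exact h1 (by rw [h]; exact cf.low_diag_inr f _)
    refine ⟨m, ?_⟩
    have : (P.val * (N * R) * P.inv) ^ m = P.val * (N * R) ^ m * P.inv := Units.conj_pow P _ m
    rw [this] at hm
    calc (N * R) ^ m = P.inv * (P.val * (N * R) ^ m * P.inv) * P.val := by
          rw [mul_assoc, mul_assoc P.val, mul_assoc, ← mul_assoc P.inv, P.inv_val, one_mul,
            mul_assoc, P.inv_val, mul_one]
      _ = 0 := by rw [hm, mul_zero, zero_mul]
  rw [EmbeddingLike.map_eq_zero_iff] at hzero
  obtain ⟨k, l, -, hkl⟩ := cf.realized_inr f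
  have := hentry (cf.e.symm ⟨k, ⟨0, cf.blockDim_pos _⟩⟩) (cf.e.symm ⟨l, ⟨0, cf.blockDim_pos _⟩⟩)
  rw [hzero, Equiv.apply_symm_apply, Equiv.apply_symm_apply, hkl, if_pos rfl, mul_zero, zero_mul,
    Matrix.zero_apply] at this
  exact zero_ne_one this

end Negligible

/-! ### Equality of physical subspaces -/

section PhysicalSubspace

variable {ι n n' κ : Type*} [Fintype n] [DecidableEq n] [Fintype n'] [DecidableEq n']

omit [DecidableEq n] in
theorem dual_apply_trace_mul [Fintype ι] [DecidableEq ι] (C : ι → Matrix n n ℂ)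
    (φ : Module.Dual ℂ (ι → ℂ)) (Y : Matrix n n ℂ) :
    φ (fun i => (C i * Y).trace) = ((∑ i, φ (Pi.single i 1) • C i) * Y).trace := by
  rw [LinearMap.pi_apply_eq_sum_univ φ, Finset.sum_mul, trace_sum]
  refine Finset.sum_congr rfl fun i _ => ?_
  rw [Matrix.smul_mul, trace_smul, smul_eq_mul, smul_eq_mul, mul_comm]
  congr 2
  ext j
  simp [Pi.single_apply, eq_comm]

/-- The annihilator of a physical subspace consists exactly of the linear relations among the
matrices, so inclusion of relations reverses to inclusion of subspaces. -/
theorem physicalSubspace_le_of_forall_sum_smul [Fintype ι] [DecidableEq ι]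
    {A : ι → Matrix n n ℂ} {B : ι → Matrix n' n' ℂ}
    (h : ∀ c : ι → ℂ, ∑ i, c i • B i = 0 → ∑ i, c i • A i = 0) :
    physicalSubspace A ≤ physicalSubspace B := by
  rw [← Subspace.dualAnnihilator_le_dualAnnihilator_iff]
  intro φ hφ
  rw [Submodule.mem_dualAnnihilator] at hφ ⊢
  have hB : ∑ i, φ (Pi.single i 1) • B i = 0 := by
    refine ext_iff_trace_mul_right.2 fun Y => ?_
    rw [← dual_apply_trace_mul, zero_mul, trace_zero]
    exact hφ _ ⟨Y, rfl⟩
  rintro _ ⟨Y, rfl⟩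
  refine (dual_apply_trace_mul A φ Y).trans ?_
  rw [h _ hB, zero_mul, trace_zero]

/-- Relations between the matrices of one tensor also hold for a block diagonal tensor with
irreducible blocks that generates the same states. -/
theorem snd_eq_zero_of_mem_span_pow [DecidableEq κ] {A : ι → Matrix n n ℂ}
    {B : ι → Matrix n' n' ℂ} {label : n' → κ} (hdiag : ∀ i, IsLabelDiagonal label (B i))
    (hirr : ∀ k, IsIrreducibleFamily fun i => (B i).toSquareBlock label k)
    (h : ∀ N, 1 ≤ N → state 1 A N = state 1 B N) {ℓ : ℕ} (hℓ : 1 ≤ ℓ)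
    {z : Matrix n n ℂ × Matrix n' n' ℂ}
    (hz : z ∈ Submodule.span ℂ (Set.range fun i => (A i, B i)) ^ ℓ) (hz1 : z.1 = 0) :
    z.2 = 0 := by
  set S := Submodule.span ℂ (Set.range fun i => (A i, B i)) with hS
  let ψ : Matrix n n ℂ × Matrix n' n' ℂ →ₐ[ℂ] End ℂ (n' → ℂ) :=
    (toLinAlgEquiv' : Matrix n' n' ℂ ≃ₐ[ℂ] _).toAlgHom.comp (AlgHom.snd ℂ _ _)
  have hψ : ∀ u, ψ u = toLinAlgEquiv' u.2 := fun _ => rfl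
  have hmap : ∀ j, operatorSpan B ^ j = (S ^ j).map ψ.toLinearMap := by
    intro j
    rw [Submodule.map_pow]
    congr 1
    rw [operatorSpan, hS, Submodule.map_span, Submodule.map_span, ← Set.range_comp,
      ← Set.range_comp]
    rfl
  have hU := fun k => isIrreducibleOn_operatorSpan hdiag (hirr k)
  have hzmem : ψ z ∈ operatorSpan B ^ ℓ := by
    rw [hmap]
    exact ⟨z, hz, rfl⟩
  -- Powers of `z * u` are combinations of pairs of words of one positive length, so the traces of
  -- the two components agree; those of the first vanish because `z.1 = 0`.
  have : ψ z = 0 := by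
    refine eq_zero_of_isNilpotent_mul hU (iSup_labelSubspace label)
      (fun k => mem_stabilizer_of_mem_pow (hU k).invariant ℓ _ hzmem) fun j w hw => ?_
    rw [hmap] at hw
    obtain ⟨u, hu, rfl⟩ := hw
    have : ψ z * ψ.toLinearMap u = toLinAlgEquiv' (z * u).2 := by
      rw [← hψ, map_mul]; rfl
    rw [this]
    refine IsNilpotent.map (isNilpotent_matrix_of_trace_pow_eq_zero _ fun k hk => ?_) _
    have hpow : (z * u) ^ k ∈ S ^ ((ℓ + j) * k) := by
      rw [pow_mul S, pow_add S]
      exact Submodule.pow_mem_pow _ (Submodule.mul_mem_mul hz hu) k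
    have := trace_eq_of_mem_span_pow h (Nat.mul_pos (by omega) hk) hpow
    rw [Prod.pow_fst, Prod.pow_snd, Prod.fst_mul, hz1, zero_mul, zero_pow (by omega),
      trace_zero] at this
    exact this.symm
  rw [hψ, EmbeddingLike.map_eq_zero_iff] at this
  exact this

theorem prodMk_blockSites_mem_span_pow (A : ι → Matrix n n ℂ) (B : ι → Matrix n' n' ℂ) (ℓ : ℕ)
    (w : Fin ℓ → ι) : (blockSites A ℓ w, blockSites B ℓ w) ∈
      Submodule.span ℂ (Set.range fun i => (A i, B i)) ^ ℓ := by
  rw [← span_range_listProd]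
  refine Submodule.subset_span ⟨w, ?_⟩
  have hA := map_list_prod (RingHom.fst (Matrix n n ℂ) (Matrix n' n' ℂ))
    (List.ofFn fun k => (A (w k), B (w k)))
  have hB := map_list_prod (RingHom.snd (Matrix n n ℂ) (Matrix n' n' ℂ))
    (List.ofFn fun k => (A (w k), B (w k)))
  rw [List.map_ofFn] at hA hB
  exact Prod.ext hA hB

/-- Tensors whose matrices are corresponding combinations of words have nested physical
subspaces. -/
theorem physicalSubspace_le_of_mem_span_pow {ω : Type*} [Fintype ω] [DecidableEq κ]
    {A : ι → Matrix n n ℂ} {B : ι → Matrix n' n' ℂ} {label : n' → κ}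
    (hdiag : ∀ i, IsLabelDiagonal label (B i))
    (hirr : ∀ k, IsIrreducibleFamily fun i => (B i).toSquareBlock label k)
    (h : ∀ N, 1 ≤ N → state 1 A N = state 1 B N) {ℓ : ℕ} (hℓ : 1 ≤ ℓ)
    {C : ω → Matrix n n ℂ} {D : ω → Matrix n' n' ℂ}
    (hCD : ∀ i, (C i, D i) ∈ Submodule.span ℂ (Set.range fun i => (A i, B i)) ^ ℓ) :
    physicalSubspace D ≤ physicalSubspace C := by
  classical
  refine physicalSubspace_le_of_forall_sum_smul fun c hc => ?_
  have hz := sum_mem fun i (_ : i ∈ Finset.univ) => Submodule.smul_mem _ (c i) (hCD i)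
  have := snd_eq_zero_of_mem_span_pow hdiag hirr h hℓ hz (by rw [Prod.fst_sum]; exact hc)
  rw [Prod.snd_sum] at this
  exact this

end PhysicalSubspace

/-! ### Stacked tensors and the conditions for a reduced pair -/

section Assembly

theorem IsIrreducibleFamily.submatrix {ι m m' : Type*} [Fintype m] [Fintype m']
    {A : ι → Matrix m m ℂ} (h : IsIrreducibleFamily A) (e : m' ≃ m) :
    IsIrreducibleFamily fun i => (A i).submatrix e e := by
  obtain ⟨⟨x⟩, h⟩ := h
  refine ⟨⟨e.symm x⟩, fun W hW => ?_⟩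
  let E : (m → ℂ) ≃ₗ[ℂ] (m' → ℂ) := LinearEquiv.funCongrLeft ℂ ℂ e
  have hE : ∀ i v, E (A i *ᵥ v) = (A i).submatrix e e *ᵥ E v := by
    intro i v
    have hv : E v ∘ e.symm = v := funext fun x => congrArg v (e.apply_symm_apply x)
    rw [submatrix_mulVec_equiv, hv]
    rfl
  rcases h (W.comap E.toLinearMap) fun i v hv => by
    have := hW i _ hv
    rw [Submodule.mem_comap]
    exact (hE i v).symm ▸ this with h0 | h0
  · left
    rw [← Submodule.map_comap_eq_of_surjective E.surjective W]
    exact (congrArg _ h0).trans (Submodule.map_bot _)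
  · right
    rw [← Submodule.map_comap_eq_of_surjective E.surjective W]
    exact (congrArg _ h0).trans ((Submodule.map_top _).trans (LinearMap.range_eq_top.2 E.surjective))

variable {ι n κ n' κ' : Type*}

theorem isLabelDiagonal_stack {A : ι → Matrix n n ℂ} {B : ι → Matrix n' n' ℂ} {a : n → κ}
    {b : n' → κ'} (hA : ∀ i, IsLabelDiagonal a (A i)) (hB : ∀ i, IsLabelDiagonal b (B i)) (i : ι) :
    IsLabelDiagonal (stackLabel a b) (stack A B i) := by
  rintro (x | x) (y | y) h
  · exact hA i x y fun h' => h (congrArg (fun k => toLex (Sum.inl k)) h')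
  · rfl
  · rfl
  · exact hB i x y fun h' => h (congrArg (fun k => toLex (Sum.inr k)) h')

variable [Fintype n] [DecidableEq n] [LinearOrder κ] [Fintype n'] [DecidableEq n'] [LinearOrder κ']

omit [DecidableEq n] [DecidableEq n'] in
theorem isIrreducibleFamily_stack {A : ι → Matrix n n ℂ} {B : ι → Matrix n' n' ℂ} {a : n → κ}
    {b : n' → κ'} (hA : ∀ k, IsIrreducibleFamily fun i => (A i).toSquareBlock a k)
    (hB : ∀ k, IsIrreducibleFamily fun i => (B i).toSquareBlock b k) (k : Lex (κ ⊕ κ')) :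
    IsIrreducibleFamily fun i => (stack A B i).toSquareBlock (stackLabel a b) k := by
  obtain ⟨k | k, rfl⟩ := toLex.surjective k
  · let e : {x : n // a x = k} ≃ {x // stackLabel a b x = toLex (Sum.inl k)} :=
      { toFun := fun x => ⟨Sum.inl x.1, congrArg (fun k => toLex (Sum.inl k)) x.2⟩
        invFun := fun x => match x with
          | ⟨Sum.inl x, hx⟩ => ⟨x, Sum.inl_injective (toLex.injective hx)⟩
          | ⟨Sum.inr x, hx⟩ => absurd (toLex.injective hx) Sum.inr_ne_inl
        left_inv := fun _ => rfl
        right_inv := fun x => match x with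
          | ⟨Sum.inl x, hx⟩ => rfl
          | ⟨Sum.inr x, hx⟩ => absurd (toLex.injective hx) Sum.inr_ne_inl }
    have h : (fun i => (stack A B i).toSquareBlock (stackLabel a b) _) =
        fun i => ((A i).toSquareBlock a k).submatrix e.symm e.symm := by
      ext i x y
      obtain ⟨x, rfl⟩ := e.surjective x
      obtain ⟨y, rfl⟩ := e.surjective y
      rw [submatrix_apply, e.symm_apply_apply, e.symm_apply_apply]
      rfl
    rw [h]
    exact (hA k).submatrix e.symm
  · let e : {x : n' // b x = k} ≃ {x // stackLabel a b x = toLex (Sum.inr k)} :=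
      { toFun := fun x => ⟨Sum.inr x.1, congrArg (fun k => toLex (Sum.inr k)) x.2⟩
        invFun := fun x => match x with
          | ⟨Sum.inr x, hx⟩ => ⟨x, Sum.inr_injective (toLex.injective hx)⟩
          | ⟨Sum.inl x, hx⟩ => absurd (toLex.injective hx) Sum.inl_ne_inr
        left_inv := fun _ => rfl
        right_inv := fun x => match x with
          | ⟨Sum.inr x, hx⟩ => rfl
          | ⟨Sum.inl x, hx⟩ => absurd (toLex.injective hx) Sum.inl_ne_inr }
    have h : (fun i => (stack A B i).toSquareBlock (stackLabel a b) _) =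
        fun i => ((B i).toSquareBlock b k).submatrix e.symm e.symm := by
      ext i x y
      obtain ⟨x, rfl⟩ := e.surjective x
      obtain ⟨y, rfl⟩ := e.surjective y
      rw [submatrix_apply, e.symm_apply_apply, e.symm_apply_apply]
      rfl
    rw [h]
    exact (hB k).submatrix e.symm

theorem Rep.IsUniformPBC.noNegligibleBlocks [Fintype ι] {M : Rep ι n κ}
    (hM : M.IsUniformPBC) : M.NoNegligibleBlocks := by
  refine ⟨?_, fun ℓ hℓ P cf t => ?_⟩
  · obtain ⟨L, hL, P, -, h⟩ := exists_matrixCF_refines hM.2 M.irreducible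
    exact ⟨L, hL, P, fun m hm => let ⟨cf, _⟩ := h m hm; ⟨cf⟩⟩
  · rw [hM.1, mul_one, P.val_inv]
    rcases t with j | f
    · exact cf.not_negligible_inl j
    · exact ((cf.isEmpty_fin_g hM.2 M.irreducible hℓ).false f).elim

/-- The stacked tensor is again block diagonal with irreducible blocks, so its canonical form arises
exactly as for a single tensor, by a strictly block diagonal gauge. -/
theorem Rep.IsUniformPBC.noAdditiveGaugeFreedom {M : Rep ι n κ} {M' : Rep ι n' κ'}
    (hM : M.IsUniformPBC) (hM' : M'.IsUniformPBC) : M.NoAdditiveGaugeFreedom M' :=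
  exists_matrixCF_refines (isLabelDiagonal_stack hM.2 hM'.2)
    (isIrreducibleFamily_stack M.irreducible M'.irreducible)

theorem Rep.IsUniformPBC.state_eq {M : Rep ι n κ} {M' : Rep ι n' κ'} (hM : M.IsUniformPBC)
    (hM' : M'.IsUniformPBC) (h : M.Equivalent M') (N : ℕ) (hN : 1 ≤ N) :
    state 1 M.tensor N = state 1 M'.tensor N := by
  have := h N hN
  rwa [hM.1, hM'.1] at this

theorem Rep.IsUniformPBC.physicalSubspace_le [Fintype ι] {M : Rep ι n κ} {M' : Rep ι n' κ'}
    (hM : M.IsUniformPBC) (hM' : M'.IsUniformPBC) (h : M.Equivalent M') :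
    physicalSubspace M'.tensor ≤ physicalSubspace M.tensor :=
  physicalSubspace_le_of_mem_span_pow hM'.2 M'.irreducible (hM.state_eq hM' h) le_rfl fun i => by
    rw [pow_one]
    exact Submodule.subset_span ⟨i, rfl⟩

theorem Rep.IsUniformPBC.physicalSubspace_blockSites_le [Fintype ι] {M : Rep ι n κ}
    {M' : Rep ι n' κ'} (hM : M.IsUniformPBC) (hM' : M'.IsUniformPBC) (h : M.Equivalent M') {ℓ : ℕ}
    (hℓ : 1 ≤ ℓ) : physicalSubspace (blockSites M'.tensor ℓ) ≤
      physicalSubspace (blockSites M.tensor ℓ) :=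
  physicalSubspace_le_of_mem_span_pow hM'.2 M'.irreducible (hM.state_eq hM' h) hℓ
    (prodMk_blockSites_mem_span_pow M.tensor M'.tensor ℓ)

end Assembly

end MPSX

theorem mainTheorem4 {d : ℕ} {n κ n' κ' : Type}
    [Fintype n] [DecidableEq n] [LinearOrder κ]
    [Fintype n'] [DecidableEq n'] [LinearOrder κ']
    (M : MPSX.Rep (Fin d) n κ) (M' : MPSX.Rep (Fin d) n' κ')
    (hM : M.IsUniformPBC) (hM' : M'.IsUniformPBC) (h : M.Equivalent M') :
    MPSX.IsReducedPair M M' := by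
  have h' : M'.Equivalent M := fun N hN => (h N hN).symm
  exact
    { equivalent := h
      no_negligible_left := hM.noNegligibleBlocks
      no_negligible_right := hM'.noNegligibleBlocks
      no_additive_left := hM.noAdditiveGaugeFreedom hM'
      no_additive_right := hM'.noAdditiveGaugeFreedom hM
      same_subspace := le_antisymm (hM'.physicalSubspace_le hM h') (hM.physicalSubspace_le hM' h)
      same_subspace_blocked := fun ℓ hℓ =>
        le_antisymm (hM'.physicalSubspace_blockSites_le hM h' hℓ)
          (hM.physicalSubspace_blockSites_le hM' h hℓ) }
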